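/- Let $n\ge 0$, $\phi=\begin{pmatrix}E&0\\0&-E\end{pmatrix}$ with $E$ the $n\times n$ unit matrix, $U(n,n)=\{g\in GL(2n,\mathbb C): g^+\phi g=\phi\}$, and $\mathbf u(n,n)=\{\mathfrak X: \mathfrak X^+\phi+\phi\mathfrak X=0\}$. Let $iH(n)$ be the real space of anti-Hermitian $n\times n$ matrices. For a subspace $z\subset\mathbb C^{2n}$ let $z^\perp$ be its orthogonal complement for $\langle v,w\rangle=v^+\phi w$. Let $\mathrm{Gr}_0$ be the Grassmannian of $n$-dimensional subspaces $z\subset\mathbb C^{2n}$ with $z=z^\perp$, and $$\mathcal N_0=\{(\mathfrak X,z)\in\mathfrak{gl}(2n,\mathbb C)\times \mathrm{Gr}_0:\ \operatorname{Im}\mathfrak X\subset z\subset\operatorname{Ker}\mathfrak X,\ -\phi\mathfrak X^+\phi=\mathfrak X\},$$ a real vector bundle over $\mathrm{Gr}_0$. Identify $U(n)\times iH(n)$ with $T^*U(n)$ by letting $(Z,\rho)$ be the covector $v\mapsto \mathrm{Tr}(\rho Z^+v)$ on $T_ZU(n)=Z\cdot iH(n)$; this is a (fibrewise linear) diffeomorphism.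 For $g=\begin{pmatrix}A&B\\C&D\end{pmatrix}\in U(n,n)$ put $$\Lambda_g(Z,\rho)=\big((AZ+B)(CZ+D)^{-1},\ (CZ+D)\rho(CZ+D)^+\big),\qquad \Sigma_g(\mathfrak X,z)=(g\mathfrak Xg^{-1},gz).$$ These are well-defined smooth actions of $U(n,n)$ on $U(n)\times iH(n)$ and on $\mathcal N_0$. (i) The map $$\mathbf I_0(Z,\rho)=\left(\begin{pmatrix}-Z\rho Z^+&Z\rho\\(Z\rho)^+&\rho\end{pmatrix},\ \{(Z\xi,\xi):\xi\in\mathbb C^n\}\right)$$ is an isomorphism of vector bundles $T^*U(n)\cong U(n)\times iH(n)\to\mathcal N_0$ over the diffeomorphism $U(n)\to \mathrm{Gr}_0$, $Z\mapsto\{(Z\xi,\xi):\xi\in\mathbb C^n\}$, and $\mathbf I_0\circ\Lambda_g=\Sigma_g\circ\mathbf I_0$ for all $g\in U(n,n)$. (ii) In the coordinates $(Z,\rho)$ the canonical one-form of $T^*U(n)$ is the (real) form $\gamma_0=\mathrm{Tr}(\rho Z^+dZ)$, and it is invariant under $\Lambda_g$ for all $g\in U(n,n)$. (iii) The form $d\gamma_0$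 is symplectic. Define Hamiltonian vector fields by $d\gamma_0(X_f,\cdot)=df$ and the Poisson bracket by $\{f,h\}=d\gamma_0(X_f,X_h)$. The smooth map $\mathbf J_0=\mathrm{pr}_1\circ\mathbf I_0:T^*U(n)\to\mathbf u(n,n)$ is $U(n,n)$-equivariant, $g\,\mathbf J_0(x)\,g^{-1}=\mathbf J_0(\Lambda_g x)$. It is a momentum map: for every $\xi\in\mathbf u(n,n)$ the velocity at $t=0$ of $t\mapsto\Lambda_{\exp(t\xi)}x$ is the Hamiltonian vector at $x$ of the function $\mathrm{Tr}(\mathbf J_0\,\xi)$. It is a Poisson map into the Lie–Poisson space $\mathbf u(n,n)\cong\mathbf u(n,n)^*$ (identified by the trace form $\mathrm{Tr}(\mathfrak X\mathfrak Y)$), i.e. $\{f\circ\mathbf J_0,h\circ\mathbf J_0\}=\{f,h\}_{L\text{-}P}\circ\mathbf J_0$ for $f,h\in C^\infty(\mathbf u(n,n),\mathbb R)$, where $\{f,h\}_{L\text{-}P}(\mathfrak X)=\mathrm{Tr}(\mathfrak X[df(\mathfrak X),dh(\mathfrak X)])$. At $\mathfrak X=\begin{pmatrix}\alpha&\beta\\\beta^+&\delta\end{pmatrix}$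 this bracket is $$\begin{aligned}\{f,h\}_{L\text{-}P}=\mathrm{Tr}\Big(&\alpha\big([\tfrac{\partial f}{\partial\alpha},\tfrac{\partial h}{\partial\alpha}]+\tfrac{\partial f}{\partial\beta}\tfrac{\partial h}{\partial\beta^+}-\tfrac{\partial h}{\partial\beta}\tfrac{\partial f}{\partial\beta^+}\big)\\ &+\beta\big(\tfrac{\partial f}{\partial\beta^+}\tfrac{\partial h}{\partial\alpha}+\tfrac{\partial f}{\partial\delta}\tfrac{\partial h}{\partial\beta^+}-\tfrac{\partial h}{\partial\beta^+}\tfrac{\partial f}{\partial\alpha}-\tfrac{\partial h}{\partial\delta}\tfrac{\partial f}{\partial\beta^+}\big)\\ &+\beta^+\big(\tfrac{\partial f}{\partial\alpha}\tfrac{\partial h}{\partial\beta}+\tfrac{\partial f}{\partial\beta}\tfrac{\partial h}{\partial\delta}-\tfrac{\partial h}{\partial\alpha}\tfrac{\partial f}{\partial\beta}-\tfrac{\partial h}{\partial\beta}\tfrac{\partial f}{\partial\delta}\big)\\ &+\delta\big([\tfrac{\partial f}{\partial\delta},\tfrac{\partial h}{\partial\delta}]+\tfrac{\partial f}{\partial\beta^+}\tfrac{\partial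 h}{\partial\beta}-\tfrac{\partial h}{\partial\beta^+}\tfrac{\partial f}{\partial\beta}\big)\Big),\end{aligned}$$ where $\frac{\partial f}{\partial\alpha},\frac{\partial f}{\partial\delta}\in iH(n)$, $\frac{\partial f}{\partial\beta^+}=(\frac{\partial f}{\partial\beta})^+$ and $df=\mathrm{Tr}\big(d\alpha\frac{\partial f}{\partial\alpha}+d\beta\frac{\partial f}{\partial\beta^+}+d\beta^+\frac{\partial f}{\partial\beta}+d\delta\frac{\partial f}{\partial\delta}\big)$. -/

import Mathlib

open scoped Matrix Matrix.Norms.Operator ContDiff Topology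

noncomputable section

namespace CotUn

/-! ### Manifolds embedded in a finite-dimensional real vector space

All manifolds below (`U(n)`, `iH(n)`, `T*U(n)`, the isotropic Grassmannian, `N₀`, `u(n,n)`) are
embedded submanifolds of spaces of matrices.  Smooth maps, smooth curves, tangent spaces and the
exterior derivative of a one-form are taken in the classical sense for embedded submanifolds. -/

/-- A set `M` with an injection into a real normed space `E`. -/
class Embedded (M : Type*) (E : outParam Type*) [NormedAddCommGroup E] [NormedSpace ℝ E] where
  emb : M → E
  inj : Function.Injective emb

section Calculus

variable {M N E F : Type*} [NormedAddCommGroup E] [NormedSpace ℝ E] [Embedded M E]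
  [NormedAddCommGroup F] [NormedSpace ℝ F] [Embedded N F]

def emb (x : M) : E := Embedded.emb x

/-- A map is smooth if it extends locally to a `C^∞` map between the ambient spaces. -/
def IsSmooth (f : M → N) : Prop :=
  ∀ x : M, ∃ V : Set E, IsOpen V ∧ emb x ∈ V ∧
    ∃ G : E → F, ContDiffOn ℝ ∞ G V ∧ ∀ y : M, emb y ∈ V → G (emb y) = emb (f y)

/-- A bijection that is smooth together with its inverse. -/
def IsDiffeo (f : M → N) : Prop :=
  ∃ h : N → M, Function.LeftInverse h f ∧ Function.RightInverse h f ∧ IsSmooth f ∧ IsSmooth h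

instance instEmbeddedProd : Embedded (M × N) (E × F) where
  emb p := (emb p.1, emb p.2)
  inj _ _ h := Prod.ext (Embedded.inj (Prod.ext_iff.1 h).1) (Embedded.inj (Prod.ext_iff.1 h).2)

/-- A smooth curve `t ↦ c(t)` in `M`. -/
structure SmoothCurve (M : Type*) {E : Type*} [NormedAddCommGroup E] [NormedSpace ℝ E]
    [Embedded M E] where
  toFun : ℝ → M
  smooth : ContDiff ℝ ∞ (fun t => emb (toFun t))

/-- The tangent space of `M` at `x`, spanned by the velocities of the smooth curves through `x`. -/
def Tan (x : M) : Submodule ℝ E :=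
  Submodule.span ℝ {v | ∃ c : SmoothCurve M, c.toFun 0 = x ∧ v = deriv (fun t => emb (c.toFun t)) 0}

theorem SmoothCurve.deriv_mem (c : SmoothCurve M) (t : ℝ) :
    deriv (fun s => emb (c.toFun s)) t ∈ Tan (c.toFun t) := by
  refine Submodule.subset_span ⟨⟨fun s => c.toFun (s + t), ?_⟩, by simp, ?_⟩
  · exact c.smooth.comp (contDiff_id.add contDiff_const)
  · simp only
    rw [deriv_comp_add_const (fun s => emb (c.toFun s)) t 0, zero_add]

/-- The velocity of a smooth curve at time `t`. -/
def SmoothCurve.vel (c : SmoothCurve M) (t : ℝ) : Tan (c.toFun t) :=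
  ⟨deriv (fun s => emb (c.toFun s)) t, c.deriv_mem t⟩

/-- A smooth two-parameter family `(s, t) ↦ σ(s, t)` of points of `M`. -/
structure SmoothSurface (M : Type*) {E : Type*} [NormedAddCommGroup E] [NormedSpace ℝ E]
    [Embedded M E] where
  toFun : ℝ → ℝ → M
  smooth : ContDiff ℝ ∞ (fun p : ℝ × ℝ => emb (toFun p.1 p.2))

def SmoothSurface.curve₁ (σ : SmoothSurface M) (t : ℝ) : SmoothCurve M where
  toFun s := σ.toFun s t
  smooth := σ.smooth.comp (contDiff_id.prodMk contDiff_const)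

def SmoothSurface.curve₂ (σ : SmoothSurface M) (s : ℝ) : SmoothCurve M where
  toFun t := σ.toFun s t
  smooth := σ.smooth.comp (contDiff_const.prodMk contDiff_id)

/-- `∂σ/∂s` -/
def SmoothSurface.vel₁ (σ : SmoothSurface M) (s t : ℝ) : Tan (σ.toFun s t) := (σ.curve₁ t).vel s

/-- `∂σ/∂t` -/
def SmoothSurface.vel₂ (σ : SmoothSurface M) (s t : ℝ) : Tan (σ.toFun s t) := (σ.curve₂ s).vel t

/-- `Ω = dγ`: for every smooth two-parameter family `σ` one has
`Ω(∂ₛσ, ∂ₜσ) = ∂ₛ(γ(∂ₜσ)) - ∂ₜ(γ(∂ₛσ))`. -/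
def IsExteriorDerivative (γ : ∀ x : M, Tan x →ₗ[ℝ] ℝ) (Ω : ∀ x : M, Tan x →ₗ[ℝ] Tan x →ₗ[ℝ] ℝ) :
    Prop :=
  ∀ σ : SmoothSurface M, ∃ a b : ℝ,
    HasDerivAt (fun s => γ (σ.toFun s 0) (σ.vel₂ s 0)) a 0 ∧
    HasDerivAt (fun t => γ (σ.toFun 0 t) (σ.vel₁ 0 t)) b 0 ∧
    Ω (σ.toFun 0 0) (σ.vel₁ 0 0) (σ.vel₂ 0 0) = a - b

/-- `V` is the value at `x` of the Hamiltonian vector field of `f`, i.e. `Ω(V, ·) = df` at `x`. -/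
def IsHamiltonianVector (Ω : ∀ x : M, Tan x →ₗ[ℝ] Tan x →ₗ[ℝ] ℝ) (f : M → ℝ) (x : M) (V : Tan x) :
    Prop :=
  ∀ (c : SmoothCurve M) (W : Tan x), c.toFun 0 = x →
    (W : E) = deriv (fun t => emb (c.toFun t)) 0 →
      HasDerivAt (fun t => f (c.toFun t)) (Ω x V W) 0

/-- `b` is the value at `x` of the Poisson bracket `{f, h} = Ω(X_f, X_h)`. -/
def IsPoissonBracket (Ω : ∀ x : M, Tan x →ₗ[ℝ] Tan x →ₗ[ℝ] ℝ) (f h : M → ℝ) (x : M) (b : ℝ) :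
    Prop :=
  ∃ V W : Tan x, IsHamiltonianVector Ω f x V ∧ IsHamiltonianVector Ω h x W ∧ Ω x V W = b

end Calculus

/-! ### Matrices -/

abbrev Mat (n : ℕ) : Type := Matrix (Fin n) (Fin n) ℂ

/-- `2n × 2n` matrices, acting on `ℂ^{2n} = ℂⁿ ⊕ ℂⁿ`. -/
abbrev Mat2 (n : ℕ) : Type := Matrix (Fin n ⊕ Fin n) (Fin n ⊕ Fin n) ℂ

abbrev Vec2 (n : ℕ) : Type := Fin n ⊕ Fin n → ℂ

/-- The unitary group `U(n)`. -/
abbrev U (n : ℕ) : Type := Matrix.unitaryGroup (Fin n) ℂ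

/-- `iH(n)`, the anti-Hermitian matrices. -/
def iH (n : ℕ) : Submodule ℝ (Mat n) where
  carrier := {a | aᴴ = -a}
  add_mem' {a b} ha hb := by
    simp only [Set.mem_ofPred_eq] at *
    rw [Matrix.conjTranspose_add, ha, hb, neg_add]
  zero_mem' := by simp
  smul_mem' r a ha := by
    simp only [Set.mem_ofPred_eq] at *
    rw [Matrix.conjTranspose_smul, ha]; simp

theorem mem_iH {n : ℕ} {a : Mat n} : a ∈ iH n ↔ aᴴ = -a := Iff.rfl

/-- The Hermitian form of signature `(n, n)`, in diagonal block form. -/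
def phi (n : ℕ) : Mat2 n := Matrix.fromBlocks 1 0 0 (-1)

theorem phi_mul_phi (n : ℕ) : phi n * phi n = 1 := by
  simp [phi, Matrix.fromBlocks_multiply]

theorem phi_conjTranspose (n : ℕ) : (phi n)ᴴ = phi n := by
  simp [phi, Matrix.fromBlocks_conjTranspose]

/-- The group `U(n,n)`, as a subgroup of `GL(2n, ℂ)`. -/
def unnGroup (n : ℕ) : Subgroup (GL (Fin n ⊕ Fin n) ℂ) where
  carrier := {g | (g : Mat2 n)ᴴ * phi n * (g : Mat2 n) = phi n}
  mul_mem' {g h} hg hh := by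
    simp only [Set.mem_ofPred_eq] at *
    rw [Units.val_mul, Matrix.conjTranspose_mul]
    calc _ = (h : Mat2 n)ᴴ * ((g : Mat2 n)ᴴ * phi n * (g : Mat2 n)) * (h : Mat2 n) := by
          simp only [mul_assoc]
      _ = _ := by rw [hg, hh]
  one_mem' := by simp
  inv_mem' {g} hg := by
    simp only [Set.mem_ofPred_eq] at *
    have h1 : (g : Mat2 n) * (g⁻¹ : GL (Fin n ⊕ Fin n) ℂ).val = 1 := Units.mul_inv g
    have h2 : ((g⁻¹ : GL (Fin n ⊕ Fin n) ℂ).val)ᴴ * (g : Mat2 n)ᴴ = 1 := by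
      rw [← Matrix.conjTranspose_mul, h1, Matrix.conjTranspose_one]
    set k := (g⁻¹ : GL (Fin n ⊕ Fin n) ℂ).val
    calc kᴴ * phi n * k = kᴴ * ((g : Mat2 n)ᴴ * phi n * (g : Mat2 n)) * k := by rw [hg]
      _ = (kᴴ * (g : Mat2 n)ᴴ) * phi n * ((g : Mat2 n) * k) := by simp only [mul_assoc]
      _ = phi n := by rw [h1, h2, one_mul, mul_one]

abbrev Unn (n : ℕ) : Type := unnGroup n

/-- The underlying matrix of an element of `U(n,n)`. -/
def Unn.mat {n : ℕ} (g : Unn n) : Mat2 n := ((g : GL (Fin n ⊕ Fin n) ℂ) : Mat2 n)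

theorem Unn.mat_spec {n : ℕ} (g : Unn n) : g.matᴴ * phi n * g.mat = phi n := g.2

theorem Unn.mat_mul_inv {n : ℕ} (g : Unn n) : g.mat * (g⁻¹).mat = 1 :=
  Units.mul_inv (g : GL (Fin n ⊕ Fin n) ℂ)

theorem Unn.inv_mul_mat {n : ℕ} (g : Unn n) : (g⁻¹).mat * g.mat = 1 :=
  Units.inv_mul (g : GL (Fin n ⊕ Fin n) ℂ)

theorem Unn.inv_mat {n : ℕ} (g : Unn n) : (g⁻¹).mat = phi n * g.matᴴ * phi n := by
  calc (g⁻¹).mat = phi n * phi n * (g⁻¹).mat := by rw [phi_mul_phi, one_mul]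
    _ = phi n * (g.matᴴ * phi n * g.mat) * (g⁻¹).mat := by rw [g.mat_spec]
    _ = phi n * g.matᴴ * phi n * (g.mat * (g⁻¹).mat) := by simp only [mul_assoc]
    _ = _ := by rw [g.mat_mul_inv, mul_one]

/-- The Lie algebra `u(n,n)`. -/
def unn (n : ℕ) : Submodule ℝ (Mat2 n) where
  carrier := {X | Xᴴ * phi n + phi n * X = 0}
  add_mem' {a b} ha hb := by
    simp only [Set.mem_ofPred_eq] at *
    rw [Matrix.conjTranspose_add, add_mul, mul_add, add_add_add_comm, ha, hb, add_zero]
  zero_mem' := by simp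
  smul_mem' r a ha := by
    simp only [Set.mem_ofPred_eq] at *
    rw [Matrix.conjTranspose_smul, star_trivial, smul_mul_assoc, mul_smul_comm, ← smul_add, ha,
      smul_zero]

theorem mem_unn {n : ℕ} {X : Mat2 n} : X ∈ unn n ↔ Xᴴ * phi n + phi n * X = 0 := Iff.rfl

/-- The exponential map `u(n,n) → U(n,n)`. -/
def expUnn {n : ℕ} (X : unn n) : Unn n :=
  ⟨⟨NormedSpace.exp (X : Mat2 n), NormedSpace.exp (-(X : Mat2 n)),
    by rw [← Matrix.exp_add_of_commute _ _ (Commute.refl (X : Mat2 n)).neg_right]; simp,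
    by rw [← Matrix.exp_add_of_commute _ _ (Commute.refl (X : Mat2 n)).neg_left]; simp⟩, by
    change (NormedSpace.exp (X : Mat2 n))ᴴ * phi n * NormedSpace.exp (X : Mat2 n) = phi n
    have hφ : phi n * phi n = 1 := phi_mul_phi n
    have hinv : (phi n)⁻¹ = phi n := Matrix.inv_eq_left_inv hφ
    have hX : (X : Mat2 n)ᴴ = phi n * (-(X : Mat2 n)) * (phi n)⁻¹ := by
      rw [hinv]
      calc (X : Mat2 n)ᴴ = (X : Mat2 n)ᴴ * phi n * phi n := by rw [mul_assoc, hφ, mul_one]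
        _ = -(phi n * X) * phi n := by rw [eq_neg_of_add_eq_zero_left (mem_unn.1 X.2)]
        _ = _ := by rw [mul_neg]
    have hu : IsUnit (phi n) := ⟨⟨phi n, phi n, hφ, hφ⟩, rfl⟩
    rw [← Matrix.exp_conjTranspose, hX, Matrix.exp_conj _ _ hu, hinv, mul_assoc (phi n * _), hφ,
      mul_one, mul_assoc, ← Matrix.exp_add_of_commute _ _ (Commute.refl (X : Mat2 n)).neg_left]
    simp⟩

instance instEmbeddedU (n : ℕ) : Embedded (U n) (Mat n) := ⟨fun Z => Z.1, Subtype.val_injective⟩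

instance instEmbeddedIH (n : ℕ) : Embedded (iH n) (Mat n) := ⟨fun a => a.1, Subtype.val_injective⟩

instance instEmbeddedUnn (n : ℕ) : Embedded (unn n) (Mat2 n) :=
  ⟨fun X => X.1, Subtype.val_injective⟩

theorem U.star_mul {n : ℕ} (Z : U n) : (Z : Mat n)ᴴ * (Z : Mat n) = 1 :=
  Matrix.mem_unitaryGroup_iff'.1 Z.2

theorem U.mul_star {n : ℕ} (Z : U n) : (Z : Mat n) * (Z : Mat n)ᴴ = 1 :=
  Matrix.mem_unitaryGroup_iff.1 Z.2

/-! ### The cotangent bundle of `U(n)` -/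

/-- `T_Z U(n) = Z · iH(n)`. -/
theorem mem_Tan_U {n : ℕ} (Z : U n) (v : Mat n) : v ∈ Tan Z ↔ (Z : Mat n)ᴴ * v ∈ iH n := by
  constructor
  · intro hv
    induction hv using Submodule.span_induction with
    | mem v hv =>
      obtain ⟨c, rfl, rfl⟩ := hv
      have hd : HasDerivAt (fun t => ((c.toFun t : U n) : Mat n))
          (deriv (fun t => emb (c.toFun t)) 0) 0 :=
        (c.smooth.differentiable (by simp)).differentiableAt.hasDerivAt
      set v := deriv (fun t => emb (c.toFun t)) 0
      have h1 : HasDerivAt (fun t => ((c.toFun t : U n) : Mat n)ᴴ) vᴴ 0 :=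
        (LinearMap.toContinuousLinearMap
          (Matrix.conjTransposeLinearEquiv (Fin n) (Fin n) ℝ ℂ).toLinearMap).hasFDerivAt.comp_hasDerivAt
          0 hd
      have h2 := h1.mul hd
      have h3 : (fun t => ((c.toFun t : U n) : Mat n)ᴴ) * (fun t => ((c.toFun t : U n) : Mat n))
          = fun _ => 1 := funext fun t => U.star_mul _
      rw [h3] at h2
      have h4 := h2.unique (hasDerivAt_const (0 : ℝ) (1 : Mat n))
      rw [mem_iH, Matrix.conjTranspose_mul, Matrix.conjTranspose_conjTranspose]
      exact eq_neg_of_add_eq_zero_left h4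
    | zero => simp
    | add x y _ _ hx hy => rw [mul_add]; exact add_mem hx hy
    | smul a x _ hx => rw [mul_smul_comm]; exact (iH n).smul_mem a hx
  · intro hv
    set τ := (Z : Mat n)ᴴ * v with hτ
    have hexp : ∀ t : ℝ, NormedSpace.exp (t • τ) ∈ Matrix.unitaryGroup (Fin n) ℂ := by
      intro t
      rw [Matrix.mem_unitaryGroup_iff', Matrix.star_eq_conjTranspose, ← Matrix.exp_conjTranspose,
        Matrix.conjTranspose_smul, mem_iH.1 hv, star_trivial, smul_neg,
        ← Matrix.exp_add_of_commute _ _ (Commute.refl (t • τ)).neg_left]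
      simp
    have hsm : ContDiff ℝ ∞ (NormedSpace.exp : Mat n → Mat n) :=
      contDiff_iff_contDiffAt.2 fun x => (NormedSpace.exp_analytic (𝕂 := ℝ) x).contDiffAt
    refine Submodule.subset_span ⟨⟨fun t => Z * ⟨NormedSpace.exp (t • τ), hexp t⟩, ?_⟩, ?_, ?_⟩
    · change ContDiff ℝ ∞ (fun t : ℝ => (Z : Mat n) * NormedSpace.exp (t • τ))
      exact contDiff_const.mul (hsm.comp (contDiff_id.smul contDiff_const))
    · refine Subtype.ext ?_
      change (Z : Mat n) * NormedSpace.exp ((0 : ℝ) • τ) = Z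
      simp
    · change v = deriv (fun t : ℝ => (Z : Mat n) * NormedSpace.exp (t • τ)) 0
      have h := (hasDerivAt_exp_smul_const (𝕂 := ℝ) τ 0).const_mul (Z : Mat n)
      refine (h.deriv.trans ?_).symm
      rw [hτ, zero_smul, NormedSpace.exp_zero, one_mul, ← mul_assoc, U.mul_star, one_mul]

/-- The total space of `T*U(n)`: pairs of a point `Z ∈ U(n)` and a covector `p : T_Z U(n) → ℝ`. -/
def CotU (n : ℕ) : Type := (Z : U n) × Module.Dual ℝ (Tan Z)

/-- The orthogonal projection of the space of matrices, with its inner product `Re Tr(a⁺b)`, onto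
`T_Z U(n)`. -/
def tanProj {n : ℕ} (Z : U n) : Mat n →ₗ[ℝ] Tan Z where
  toFun v := ⟨(1 / 2 : ℝ) • (v - Z * vᴴ * Z), by
    rw [mem_Tan_U, mul_smul_comm]
    refine (iH n).smul_mem _ ?_
    rw [mem_iH, mul_sub, ← mul_assoc, ← mul_assoc, U.star_mul, one_mul]
    simp⟩
  map_add' v w := by
    ext1
    simp only [Submodule.coe_add, Matrix.conjTranspose_add, ← smul_add, mul_add, add_mul]
    congr 1; abel
  map_smul' r v := by
    ext1
    simp only [Submodule.coe_smul, Matrix.conjTranspose_smul, star_trivial, RingHom.id_apply]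
    rw [mul_smul_comm, smul_mul_assoc, ← smul_sub, smul_comm]

theorem tanProj_apply_tan {n : ℕ} (Z : U n) (v : Tan Z) : tanProj Z v = v := by
  ext1
  change (1 / 2 : ℝ) • ((v : Mat n) - Z * (v : Mat n)ᴴ * Z) = v
  have h := mem_iH.1 ((mem_Tan_U Z v).1 v.2)
  rw [Matrix.conjTranspose_mul, Matrix.conjTranspose_conjTranspose] at h
  rw [mul_assoc, h, mul_neg, ← mul_assoc, U.mul_star, one_mul, sub_neg_eq_add, ← two_smul ℝ,
    smul_smul]
  norm_num

/-- The matrix of coordinates `ℓ(E_{jk}) + i ℓ(i E_{jk})` of a real-linear functional `ℓ`. -/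
def dualCoord {n : ℕ} (l : Module.Dual ℝ (Mat n)) : Mat n := Matrix.of fun j k =>
  (l (Matrix.single j k 1) : ℂ) + Complex.I * (l (Matrix.single j k Complex.I) : ℂ)

theorem dualCoord_injective (n : ℕ) : Function.Injective (dualCoord (n := n)) := by
  intro l m h
  have key : ∀ j k, l (Matrix.single j k 1) = m (Matrix.single j k 1) ∧
      l (Matrix.single j k Complex.I) = m (Matrix.single j k Complex.I) := by
    intro j k
    have h' := congrFun (congrFun h j) k
    simp only [dualCoord, Matrix.of_apply] at h'
    exact ⟨by simpa using congrArg Complex.re h', by simpa using congrArg Complex.im h'⟩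
  have one : ∀ j k (c : ℂ), l (Matrix.single j k c) = m (Matrix.single j k c) := by
    intro j k c
    have hc : Matrix.single j k c
        = c.re • Matrix.single j k (1 : ℂ) + c.im • Matrix.single j k Complex.I := by
      rw [Matrix.smul_single, Matrix.smul_single, ← Matrix.single_add]
      congr 1
      simp
    rw [hc, map_add, map_add, map_smul, map_smul, map_smul, map_smul, (key j k).1, (key j k).2]
  refine LinearMap.ext fun a => ?_
  rw [Matrix.matrix_eq_sum_single a]
  simp only [map_sum, one]

/-- The smooth structure of `T*U(n)`: a covector at `Z` is extended by zero to the normal space of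
`U(n)` at `Z`; this is the usual embedding of `T*U(n)` into the cotangent bundle of the space of
matrices. -/
instance instEmbeddedCotU (n : ℕ) : Embedded (CotU n) (Mat n × Mat n) where
  emb p := ((p.1 : Mat n), dualCoord (p.2.comp (tanProj p.1)))
  inj := by
    rintro ⟨Z, p⟩ ⟨W, q⟩ h
    obtain ⟨h1, h2⟩ := Prod.ext_iff.1 h
    obtain rfl : Z = W := Subtype.ext h1
    have h3 := dualCoord_injective n h2
    have : p = q := LinearMap.ext fun v => by
      have := LinearMap.congr_fun h3 (v : Mat n)
      simpa [tanProj_apply_tan] using this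
    rw [this]

/-- The differential of the bundle projection `π : T*U(n) → U(n)`. -/
def dProj {n : ℕ} (p : CotU n) : Tan p →ₗ[ℝ] Tan p.1 :=
  ((LinearMap.fst ℝ (Mat n) (Mat n)).domRestrict (Tan p)).codRestrict (Tan p.1) (by
    rintro ⟨v, hv⟩
    change v.1 ∈ Tan p.1
    induction hv using Submodule.span_induction with
    | mem v hv =>
      obtain ⟨c, rfl, rfl⟩ := hv
      refine Submodule.subset_span ⟨⟨fun t => (c.toFun t).1, c.smooth.fst⟩, rfl, ?_⟩
      have hd : HasDerivAt (fun t => emb (c.toFun t)) (deriv (fun t => emb (c.toFun t)) 0) 0 :=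
        (c.smooth.differentiable (by simp)).differentiableAt.hasDerivAt
      exact (hasFDerivAt_fst.comp_hasDerivAt 0 hd).deriv.symm
    | zero => exact zero_mem _
    | add x y _ _ hx hy => exact add_mem hx hy
    | smul a x _ hx => exact Submodule.smul_mem _ a hx)

/-- The canonical (tautological) one-form of `T*U(n)`: its value at `p` on `V` is `p(dπ V)`. -/
def canonicalForm {n : ℕ} (p : CotU n) : Tan p →ₗ[ℝ] ℝ := p.2 ∘ₗ dProj p

/-- The space `U(n) × iH(n)` of coordinates `(Z, ρ)`. -/
abbrev Phase (n : ℕ) : Type := U n × iH n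

/-- The real part of the pairing `(ρ, v) ↦ Tr(ρ Z⁺ v)`. -/
def leftPairing {n : ℕ} (Z : U n) (ρ : iH n) : Mat n →ₗ[ℝ] ℝ :=
  Complex.reLm ∘ₗ (Matrix.traceLinearMap (Fin n) ℝ ℂ) ∘ₗ
    LinearMap.mulLeft ℝ ((ρ : Mat n) * (Z : Mat n)ᴴ)

/-- The identification `U(n) × iH(n) ≅ T*U(n)` by left translation and the trace form: `(Z, ρ)`
corresponds to the covector `v ↦ Tr(ρ Z⁺ v)` at `Z`. -/
def leftTriv (n : ℕ) (x : Phase n) : CotU n := ⟨x.1, (leftPairing x.1 x.2).domRestrict (Tan x.1)⟩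

/-- The one-form `Tr(ρ Z⁺ dZ)` on `U(n) × iH(n)`. -/
def gamma0 {n : ℕ} (x : Phase n) : Tan x →ₗ[ℝ] ℝ :=
  ((leftPairing x.1 x.2) ∘ₗ LinearMap.fst ℝ (Mat n) (Mat n)).domRestrict (Tan x)

/-! ### The Grassmannian and the bundle `N₀` -/

/-- `z^⊥` with respect to `⟨v, w⟩ = v⁺ φ w`. -/
def perp {n : ℕ} (z : Submodule ℂ (Vec2 n)) : Submodule ℂ (Vec2 n) where
  carrier := {w | ∀ v ∈ z, star v ⬝ᵥ (phi n *ᵥ w) = 0}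
  add_mem' {a b} ha hb v hv := by
    rw [Matrix.mulVec_add, dotProduct_add, ha v hv, hb v hv, add_zero]
  zero_mem' v _ := by simp
  smul_mem' r a ha v hv := by rw [Matrix.mulVec_smul, dotProduct_smul, ha v hv, smul_zero]

/-- `Gr(n, ℂ^{2n})` -/
def Gr (n : ℕ) : Type := {z : Submodule ℂ (Vec2 n) // Module.finrank ℂ z = n}

/-- The matrix of the orthogonal projection of `ℂ^{2n}`, with its standard (positive definite)
Hermitian scalar product, onto `z`. -/
def projMat {n : ℕ} (z : Submodule ℂ (Vec2 n)) : Mat2 n :=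
  LinearMap.toMatrix' ((WithLp.linearEquiv 2 ℂ (Vec2 n)).toLinearMap ∘ₗ
    ((z.map (WithLp.linearEquiv 2 ℂ (Vec2 n)).symm.toLinearMap).starProjection :
      EuclideanSpace ℂ (Fin n ⊕ Fin n) →ₗ[ℂ] EuclideanSpace ℂ (Fin n ⊕ Fin n)) ∘ₗ
    (WithLp.linearEquiv 2 ℂ (Vec2 n)).symm.toLinearMap)

theorem projMat_injective (n : ℕ) : Function.Injective (projMat (n := n)) := by
  intro z w h
  have h1 := LinearMap.toMatrix'.injective h
  have h2 : (z.map (WithLp.linearEquiv 2 ℂ (Vec2 n)).symm.toLinearMap).starProjection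
      = (w.map (WithLp.linearEquiv 2 ℂ (Vec2 n)).symm.toLinearMap).starProjection := by
    ext1 v
    have := LinearMap.congr_fun h1 (WithLp.linearEquiv 2 ℂ (Vec2 n) v)
    exact WithLp.ofLp_injective 2 (by simpa using this)
  have h3 : z.map (WithLp.linearEquiv 2 ℂ (Vec2 n)).symm.toLinearMap
      = w.map (WithLp.linearEquiv 2 ℂ (Vec2 n)).symm.toLinearMap := by
    ext v
    rw [← Submodule.starProjection_eq_self_iff, ← Submodule.starProjection_eq_self_iff, h2]
  exact Submodule.map_injective_of_injective (WithLp.linearEquiv 2 ℂ (Vec2 n)).symm.injective h3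

/-- The smooth structure of the Grassmannian, through its usual embedding by orthogonal
projections. -/
instance instEmbeddedGr (n : ℕ) : Embedded (Gr n) (Mat2 n) :=
  ⟨fun z => projMat z.1, fun _ _ h => Subtype.ext (projMat_injective n h)⟩

/-- `(𝒳, z) ∈ N`, i.e. `Im 𝒳 ⊂ z ⊂ Ker 𝒳`. -/
def MemN {n : ℕ} (p : Mat2 n × Gr n) : Prop :=
  LinearMap.range p.1.mulVecLin ≤ p.2.1 ∧ p.2.1 ≤ LinearMap.ker p.1.mulVecLin

/-- The involution `I(𝒳) = -φ 𝒳⁺ φ` of `gl(2n, ℂ)`. -/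
def inv {n : ℕ} (X : Mat2 n) : Mat2 n := -(phi n * Xᴴ * phi n)

/-- The total space of `N₀`: the fixed points in `N` of `(𝒳, z) ↦ (I(𝒳), z^⊥)`. -/
def N0 (n : ℕ) : Type := {p : Mat2 n × Gr n // MemN p ∧ inv p.1 = p.1 ∧ perp p.2.1 = p.2.1}

/-- The Grassmannian of isotropic subspaces `z = z^⊥` of dimension `n`. -/
def Gr0 (n : ℕ) : Type := {z : Gr n // perp z.1 = z.1}

instance instEmbeddedN0 (n : ℕ) : Embedded (N0 n) (Mat2 n × Mat2 n) where
  emb p := (p.1.1, emb p.1.2)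
  inj _ _ h := Subtype.ext (Prod.ext (Prod.ext_iff.1 h).1 (Embedded.inj (Prod.ext_iff.1 h).2))

instance instEmbeddedGr0 (n : ℕ) : Embedded (Gr0 n) (Mat2 n) :=
  ⟨fun z => emb z.1, fun _ _ h => Subtype.ext (Embedded.inj h)⟩

/-- The bundle projection `N₀ → Gr₀`. -/
def N0.proj {n : ℕ} (p : N0 n) : Gr0 n := ⟨p.1.2, p.2.2.2⟩

/-- `pr₁(𝒳, z) = 𝒳` -/
def N0.pr₁ {n : ℕ} (p : N0 n) : Mat2 n := p.1.1

/-- The fibre of `N₀` over `z`, a real vector space of matrices. -/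
def N0.fibre {n : ℕ} (z : Gr0 n) : Submodule ℝ (Mat2 n) where
  carrier := {X | MemN (X, z.1) ∧ inv X = X}
  add_mem' {X Y} hX hY := by
    obtain ⟨⟨h1, h2⟩, h3⟩ := hX
    obtain ⟨⟨k1, k2⟩, k3⟩ := hY
    refine ⟨⟨?_, fun v hv => ?_⟩, ?_⟩
    · rintro _ ⟨v, rfl⟩
      simp only [Matrix.mulVecLin_add, LinearMap.add_apply]
      exact add_mem (h1 ⟨v, rfl⟩) (k1 ⟨v, rfl⟩)
    · have hx := h2 hv
      have hy := k2 hv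
      simp only [LinearMap.mem_ker, Matrix.mulVecLin_add, LinearMap.add_apply] at *
      rw [hx, hy, add_zero]
    · simp only [inv] at *
      rw [Matrix.conjTranspose_add, mul_add, add_mul, neg_add, h3, k3]
  zero_mem' := by
    refine ⟨⟨?_, fun v _ => ?_⟩, ?_⟩
    · rintro _ ⟨v, rfl⟩
      simp
    · simp
    · simp [inv]
  smul_mem' r X hX := by
    obtain ⟨⟨h1, h2⟩, h3⟩ := hX
    refine ⟨⟨?_, fun v hv => ?_⟩, ?_⟩
    · rintro _ ⟨v, rfl⟩
      change (r • X) *ᵥ v ∈ z.1.1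
      rw [Matrix.smul_mulVec]
      have : X *ᵥ v ∈ z.1.1 := h1 ⟨v, rfl⟩
      have := z.1.1.smul_mem (r : ℂ) this
      rwa [Complex.coe_smul] at this
    · have hx : X *ᵥ v = 0 := h2 hv
      change (r • X) *ᵥ v = 0
      rw [Matrix.smul_mulVec, hx, smul_zero]
    · simp only [inv] at *
      rw [Matrix.conjTranspose_smul, star_trivial, mul_smul_comm, smul_mul_assoc, ← smul_neg, h3]

/-- The invertible linear map `v ↦ g v` of `ℂ^{2n}`. -/
def Unn.equiv {n : ℕ} (g : Unn n) : Vec2 n ≃ₗ[ℂ] Vec2 n :=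
  LinearEquiv.ofLinearMap g.mat.mulVecLin (g⁻¹).mat.mulVecLin
    (by rw [← Matrix.mulVecLin_mul, g.mat_mul_inv, Matrix.mulVecLin_one])
    (by rw [← Matrix.mulVecLin_mul, g.inv_mul_mat, Matrix.mulVecLin_one])

theorem Unn.equiv_apply {n : ℕ} (g : Unn n) (v : Vec2 n) : g.equiv v = g.mat *ᵥ v := rfl

theorem Unn.form_invariant {n : ℕ} (g : Unn n) (v w : Vec2 n) :
    star (g.mat *ᵥ v) ⬝ᵥ (phi n *ᵥ (g.mat *ᵥ w)) = star v ⬝ᵥ (phi n *ᵥ w) := by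
  rw [Matrix.star_mulVec, ← Matrix.dotProduct_mulVec, Matrix.mulVec_mulVec, Matrix.mulVec_mulVec,
    g.mat_spec]

theorem perp_map {n : ℕ} (g : Unn n) (z : Submodule ℂ (Vec2 n)) :
    perp (z.map g.equiv.toLinearMap) = (perp z).map g.equiv.toLinearMap := by
  ext w
  obtain ⟨u, rfl⟩ := g.equiv.surjective w
  constructor
  · intro h
    refine ⟨u, fun v hv => ?_, rfl⟩
    rw [← g.form_invariant]
    exact h _ ⟨v, hv, rfl⟩
  · rintro ⟨u', hu', he⟩
    obtain rfl := g.equiv.injective he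
    rintro _ ⟨v, hv, rfl⟩
    exact (g.form_invariant v u').trans (hu' v hv)

/-- `Σ_g(𝒳, z) = (g𝒳g⁻¹, gz)` for `g ∈ U(n,n)`, as a map of `N₀`. -/
def Sig {n : ℕ} (g : Unn n) (p : N0 n) : N0 n :=
  ⟨(g.mat * p.1.1 * (g⁻¹).mat,
    ⟨p.1.2.1.map g.equiv.toLinearMap, (g.equiv.finrank_map_eq p.1.2.1).trans p.1.2.2⟩), by
    obtain ⟨⟨X, z⟩, ⟨h1, h2⟩, h3, h4⟩ := p
    change inv X = X at h3
    refine ⟨⟨?_, ?_⟩, ?_, ?_⟩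
    · rintro _ ⟨v, rfl⟩
      refine ⟨X *ᵥ ((g⁻¹).mat *ᵥ v), h1 ⟨_, rfl⟩, ?_⟩
      change g.mat *ᵥ _ = (g.mat * X * (g⁻¹).mat) *ᵥ v
      simp only [Matrix.mulVec_mulVec, mul_assoc]
    · rintro _ ⟨v, hv, rfl⟩
      change (g.mat * X * (g⁻¹).mat) *ᵥ (g.mat *ᵥ v) = 0
      have hx : X *ᵥ v = 0 := h2 hv
      rw [Matrix.mulVec_mulVec, mul_assoc, g.inv_mul_mat, mul_one, ← Matrix.mulVec_mulVec, hx,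
        Matrix.mulVec_zero]
    · change inv (g.mat * X * (g⁻¹).mat) = g.mat * X * (g⁻¹).mat
      rw [inv] at h3 ⊢
      have hk := g.inv_mat
      have hφ := phi_mul_phi n
      have hg : g.mat = phi n * ((g⁻¹).mat)ᴴ * phi n := by
        rw [hk]
        simp only [Matrix.conjTranspose_mul, Matrix.conjTranspose_conjTranspose, phi_conjTranspose]
        calc g.mat = (phi n * phi n) * g.mat * (phi n * phi n) := by rw [hφ, one_mul, mul_one]
          _ = _ := by simp only [mul_assoc]
      calc -(phi n * (g.mat * X * (g⁻¹).mat)ᴴ * phi n)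
          = -(phi n * ((g⁻¹).mat)ᴴ * 1 * Xᴴ * 1 * g.matᴴ * phi n) := by
            simp only [Matrix.conjTranspose_mul, mul_assoc, one_mul]
        _ = (phi n * ((g⁻¹).mat)ᴴ * phi n) * -(phi n * Xᴴ * phi n)
              * (phi n * g.matᴴ * phi n) := by
            rw [← hφ]
            simp only [mul_assoc, mul_neg, neg_mul]
        _ = g.mat * X * (g⁻¹).mat := by rw [h3, ← hg, ← hk]
    · change perp (z.1.map _) = z.1.map _
      exact (perp_map g z.1).trans (congrArg _ h4)⟩

/-! ### The action `Λ` and the maps `I₀`, `J₀` -/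

section Action

variable {n : ℕ}

/-- The numerator `AZ + B`, for `g` with blocks `A`, `B`, `C`, `D`. -/
def numer (g : Unn n) (Z : U n) : Mat n := g.mat.toBlocks₁₁ * Z + g.mat.toBlocks₁₂

/-- The denominator `CZ + D`. -/
def denom (g : Unn n) (Z : U n) : Mat n := g.mat.toBlocks₂₁ * Z + g.mat.toBlocks₂₂

theorem block_identities (g : Unn n) :
    (g.mat.toBlocks₁₁)ᴴ * g.mat.toBlocks₁₁ = 1 + (g.mat.toBlocks₂₁)ᴴ * g.mat.toBlocks₂₁ ∧
    (g.mat.toBlocks₁₁)ᴴ * g.mat.toBlocks₁₂ = (g.mat.toBlocks₂₁)ᴴ * g.mat.toBlocks₂₂ ∧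
    (g.mat.toBlocks₁₂)ᴴ * g.mat.toBlocks₁₁ = (g.mat.toBlocks₂₂)ᴴ * g.mat.toBlocks₂₁ ∧
    (g.mat.toBlocks₂₂)ᴴ * g.mat.toBlocks₂₂ = 1 + (g.mat.toBlocks₁₂)ᴴ * g.mat.toBlocks₁₂ := by
  have h := g.mat_spec
  rw [phi, ← Matrix.fromBlocks_toBlocks g.mat, Matrix.fromBlocks_conjTranspose,
    Matrix.fromBlocks_multiply, Matrix.fromBlocks_multiply, Matrix.fromBlocks_inj] at h
  simp only [mul_one, mul_zero, add_zero, zero_add, mul_neg, neg_mul] at h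
  obtain ⟨h1, h2, h3, h4⟩ := h
  refine ⟨?_, ?_, ?_, ?_⟩
  · rw [← h1]; abel
  · exact sub_eq_zero.1 (by rw [← h2]; abel)
  · exact sub_eq_zero.1 (by rw [← h3]; abel)
  · rw [← sub_eq_iff_eq_add, ← neg_inj, ← h4]; abel

theorem numer_star_mul (g : Unn n) (Z : U n) :
    (numer g Z)ᴴ * numer g Z = (denom g Z)ᴴ * denom g Z := by
  obtain ⟨h1, h2, h3, h4⟩ := block_identities g
  have e : ∀ P Q : Mat n, (P * (Z : Mat n) + Q)ᴴ * (P * (Z : Mat n) + Q)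
      = (Z : Mat n)ᴴ * (Pᴴ * P) * (Z : Mat n) + (Z : Mat n)ᴴ * (Pᴴ * Q) + (Qᴴ * P) * (Z : Mat n)
        + Qᴴ * Q := by
    intro P Q
    rw [Matrix.conjTranspose_add, Matrix.conjTranspose_mul]
    noncomm_ring
  rw [numer, denom, e, e, h1, h2, h3, h4, mul_add, add_mul, mul_one, U.star_mul]
  abel

open scoped ComplexOrder in
theorem denom_isUnit (g : Unn n) (Z : U n) : IsUnit (denom g Z) := by
  obtain ⟨h1, h2, h3, h4⟩ := block_identities g
  rw [← Matrix.mulVec_injective_iff_isUnit]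
  refine (injective_iff_map_eq_zero (denom g Z).mulVecLin).2 fun v hv => ?_
  replace hv : denom g Z *ᵥ v = 0 := hv
  have hN : numer g Z *ᵥ v = 0 := by
    rw [← Matrix.conjTranspose_mul_self_mulVec_eq_zero, numer_star_mul, ← Matrix.mulVec_mulVec, hv,
      Matrix.mulVec_zero]
  have key : (g.mat.toBlocks₂₂)ᴴ * denom g Z - (g.mat.toBlocks₁₂)ᴴ * numer g Z = 1 := by
    rw [numer, denom, mul_add, mul_add, ← mul_assoc, ← mul_assoc, h3, h4]
    abel
  calc v = (1 : Mat n) *ᵥ v := (Matrix.one_mulVec v).symm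
    _ = 0 := by
      rw [← key, Matrix.sub_mulVec, ← Matrix.mulVec_mulVec, ← Matrix.mulVec_mulVec, hv, hN]
      simp

/-- `Λ_g(Z, ρ) = ((AZ + B)(CZ + D)⁻¹, (CZ + D) ρ (CZ + D)⁺)` -/
def Lam (g : Unn n) (x : Phase n) : Phase n :=
  (⟨numer g x.1 * (denom g x.1)⁻¹, by
    have hu := (Matrix.isUnit_iff_isUnit_det _).1 (denom_isUnit g x.1)
    rw [Matrix.mem_unitaryGroup_iff', Matrix.star_eq_conjTranspose, Matrix.conjTranspose_mul]
    calc _ = ((denom g x.1)⁻¹)ᴴ * ((numer g x.1)ᴴ * numer g x.1) * (denom g x.1)⁻¹ := by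
          simp only [mul_assoc]
      _ = (denom g x.1 * (denom g x.1)⁻¹)ᴴ * (denom g x.1 * (denom g x.1)⁻¹) := by
          rw [numer_star_mul, Matrix.conjTranspose_mul]
          simp only [mul_assoc]
      _ = 1 := by rw [Matrix.mul_nonsing_inv _ hu]; simp⟩,
   ⟨denom g x.1 * x.2 * (denom g x.1)ᴴ, by
    have h := mem_iH.1 x.2.2
    rw [mem_iH, Matrix.conjTranspose_mul, Matrix.conjTranspose_mul,
      Matrix.conjTranspose_conjTranspose, h]
    noncomm_ring⟩)

/-- The element of `u(n,n)` with diagonal blocks `α`, `δ` and off-diagonal blocks `β`, `β⁺`. -/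
def ofBlocks (α : iH n) (β : Mat n) (δ : iH n) : unn n :=
  ⟨Matrix.fromBlocks α β βᴴ δ, by
    have h1 := mem_iH.1 α.2
    have h2 := mem_iH.1 δ.2
    rw [mem_unn, phi, Matrix.fromBlocks_conjTranspose, Matrix.fromBlocks_multiply,
      Matrix.fromBlocks_multiply, Matrix.fromBlocks_add, h1, h2, ← Matrix.fromBlocks_zero]
    simp⟩

/-- `J₀(Z, ρ)`, the matrix with blocks `-ZρZ⁺`, `Zρ`, `(Zρ)⁺`, `ρ`. -/
def J0 (x : Phase n) : unn n :=
  ofBlocks ⟨-((x.1 : Mat n) * x.2 * (x.1 : Mat n)ᴴ), by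
    have h := mem_iH.1 x.2.2
    rw [mem_iH, Matrix.conjTranspose_neg, Matrix.conjTranspose_mul, Matrix.conjTranspose_mul,
      Matrix.conjTranspose_conjTranspose, h]
    noncomm_ring⟩ ((x.1 : Mat n) * x.2) x.2

theorem J0_mulVec (x : Phase n) (v : Vec2 n) : (J0 x : Mat2 n) *ᵥ v =
    Sum.elim ((x.1 : Mat n) *ᵥ ((x.2 : Mat n) *ᵥ (v ∘ Sum.inr - (x.1 : Mat n)ᴴ *ᵥ (v ∘ Sum.inl))))
      ((x.2 : Mat n) *ᵥ (v ∘ Sum.inr - (x.1 : Mat n)ᴴ *ᵥ (v ∘ Sum.inl))) := by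
  have h := mem_iH.1 x.2.2
  have hb : ((x.1 : Mat n) * (x.2 : Mat n))ᴴ = -((x.2 : Mat n) * (x.1 : Mat n)ᴴ) := by
    rw [Matrix.conjTranspose_mul, h, neg_mul]
  simp only [J0, ofBlocks, Matrix.fromBlocks_mulVec, hb, Matrix.mulVec_sub, Matrix.mulVec_mulVec,
    Matrix.neg_mulVec, mul_assoc]
  congr 1 <;> abel

/-- The subspace of all `(Zξ, ξ)`, `ξ ∈ ℂⁿ`. -/
def graph (Z : U n) : Submodule ℂ (Vec2 n) where
  carrier := {v | ∃ ξ : Fin n → ℂ, Sum.elim ((Z : Mat n) *ᵥ ξ) ξ = v}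
  add_mem' := by
    rintro _ _ ⟨ξ, rfl⟩ ⟨η, rfl⟩
    exact ⟨ξ + η, by ext (i | i) <;> simp [Matrix.mulVec_add]⟩
  zero_mem' := ⟨0, by ext (i | i) <;> simp⟩
  smul_mem' := by
    rintro r _ ⟨ξ, rfl⟩
    exact ⟨r • ξ, by ext (i | i) <;> simp [Matrix.mulVec_smul]⟩

theorem finrank_graph (Z : U n) : Module.finrank ℂ (graph Z) = n := by
  let e : graph Z ≃ₗ[ℂ] (Fin n → ℂ) :=
    { toFun := fun v i => v.1 (Sum.inr i)
      map_add' := fun _ _ => rfl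
      map_smul' := fun _ _ => rfl
      invFun := fun ξ => ⟨Sum.elim ((Z : Mat n) *ᵥ ξ) ξ, ξ, rfl⟩
      left_inv := by rintro ⟨_, ξ, rfl⟩; rfl
      right_inv := fun _ => rfl }
  rw [e.finrank_eq, Module.finrank_fin_fun]

open scoped ComplexOrder in
theorem perp_graph (Z : U n) : perp (graph Z) = graph Z := by
  have key : ∀ (ξ : Fin n → ℂ) (w : Vec2 n),
      star (Sum.elim ((Z : Mat n) *ᵥ ξ) ξ) ⬝ᵥ (phi n *ᵥ w)
        = star ξ ⬝ᵥ ((Z : Mat n)ᴴ *ᵥ (w ∘ Sum.inl) - w ∘ Sum.inr) := by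
    intro ξ w
    have h : star (Sum.elim ((Z : Mat n) *ᵥ ξ) ξ)
        = Sum.elim (star ξ ᵥ* (Z : Mat n)ᴴ) (star ξ) := by
      rw [← Matrix.star_mulVec]
      ext (i | i) <;> rfl
    rw [h, phi, Matrix.fromBlocks_mulVec, sumElim_dotProduct_sumElim, Matrix.neg_mulVec,
      Matrix.zero_mulVec, Matrix.zero_mulVec, Matrix.one_mulVec, Matrix.one_mulVec, add_zero,
      zero_add, ← Matrix.dotProduct_mulVec, dotProduct_neg, dotProduct_sub, sub_eq_add_neg]
  ext w
  constructor
  · intro hw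
    have h0 : (Z : Mat n)ᴴ *ᵥ (w ∘ Sum.inl) - w ∘ Sum.inr = 0 := by
      rw [← dotProduct_self_star_eq_zero, dotProduct_comm, ← key]
      exact hw _ ⟨_, rfl⟩
    refine ⟨w ∘ Sum.inr, ?_⟩
    rw [← sub_eq_zero.1 h0, Matrix.mulVec_mulVec, U.mul_star, Matrix.one_mulVec, sub_eq_zero.1 h0]
    exact Sum.elim_comp_inl_inr w
  · rintro ⟨η, rfl⟩ _ ⟨ξ, rfl⟩
    rw [key, Sum.elim_comp_inl, Sum.elim_comp_inr, Matrix.mulVec_mulVec, U.star_mul,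
      Matrix.one_mulVec, sub_self, dotProduct_zero]

theorem inv_unn (X : unn n) : inv (X : Mat2 n) = X := by
  have h := eq_neg_of_add_eq_zero_left (mem_unn.1 X.2)
  rw [inv, mul_assoc, h, mul_neg, neg_neg, ← mul_assoc, phi_mul_phi, one_mul]

/-- The base map `Z ↦ {(Zξ, ξ) : ξ ∈ ℂⁿ}`, from `U(n)` to the isotropic Grassmannian. -/
def I0base (Z : U n) : Gr0 n := ⟨⟨graph Z, finrank_graph Z⟩, perp_graph Z⟩

/-- `I₀(Z, ρ)`, the pair of the matrix with blocks `-ZρZ⁺`, `Zρ`, `(Zρ)⁺`, `ρ` and of the subspace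
`{(Zξ, ξ) : ξ ∈ ℂⁿ}`. -/
def I0 (x : Phase n) : N0 n :=
  ⟨((J0 x : Mat2 n), ⟨graph x.1, finrank_graph x.1⟩), by
    refine ⟨⟨?_, ?_⟩, inv_unn _, perp_graph x.1⟩
    · rintro _ ⟨v, rfl⟩
      exact ⟨_, (J0_mulVec x v).symm⟩
    · rintro _ ⟨ξ, rfl⟩
      change (J0 x : Mat2 n) *ᵥ _ = 0
      have h0 : ξ - (x.1 : Mat n)ᴴ *ᵥ ((x.1 : Mat n) *ᵥ ξ) = 0 := by
        rw [Matrix.mulVec_mulVec, U.star_mul, Matrix.one_mulVec, sub_self]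
      rw [J0_mulVec, Sum.elim_comp_inl, Sum.elim_comp_inr, h0, Matrix.mulVec_zero,
        Matrix.mulVec_zero]
      ext (i | i) <;> rfl⟩

end Action

/-! ### The Lie-Poisson bracket of `u(n,n)` -/

section LiePoisson

variable {n : ℕ}

/-- The trace form `Tr(XY)` of `u(n,n)`, which takes real values. -/
def traceForm (n : ℕ) : LinearMap.BilinForm ℝ (unn n) :=
  LinearMap.mk₂ ℝ (fun X Y => (Matrix.trace ((X : Mat2 n) * (Y : Mat2 n))).re)
    (fun X X' Y => by simp [add_mul]) (fun r X Y => by simp)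
    (fun X Y Y' => by simp [mul_add]) (fun r X Y => by simp)

open scoped ComplexOrder in
theorem traceForm_nondegenerate (n : ℕ) : (traceForm n).Nondegenerate := by
  have hc : ∀ X : unn n, (X : Mat2 n)ᴴ ∈ unn n := by
    intro X
    have h := eq_neg_of_add_eq_zero_left (mem_unn.1 X.2)
    have hφ := phi_mul_phi n
    rw [mem_unn, Matrix.conjTranspose_conjTranspose]
    calc _ = (X : Mat2 n) * phi n + phi n * ((X : Mat2 n)ᴴ * phi n) * phi n := by
          simp only [mul_assoc, hφ, mul_one]
      _ = 0 := by
          rw [h, mul_neg, ← mul_assoc, hφ]; simp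
  have hz : ∀ X : unn n, (Matrix.trace ((X : Mat2 n) * (X : Mat2 n)ᴴ)).re = 0 → X = 0 := by
    intro X h
    have hX : Matrix.trace ((X : Mat2 n) * (X : Mat2 n)ᴴ) = 0 := by
      refine Complex.ext h ?_
      have h2 := Matrix.trace_conjTranspose ((X : Mat2 n) * (X : Mat2 n)ᴴ)
      rw [Matrix.conjTranspose_mul, Matrix.conjTranspose_conjTranspose] at h2
      exact Complex.conj_eq_iff_im.1 h2.symm
    exact Subtype.ext (Matrix.trace_mul_conjTranspose_self_eq_zero_iff.1 hX)
  constructor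
  · intro X h
    exact hz X (h ⟨_, hc X⟩)
  · intro X h
    refine hz X ?_
    rw [Matrix.trace_mul_comm]
    exact h ⟨_, hc X⟩

/-- The differential of `f` at `X`, identified with an element of `u(n,n)` through the isomorphism
`u(n,n) ≅ u(n,n)*` given by the trace form: `Tr(df(X) Y) = f'(X) Y`. -/
def grad (f : unn n → ℝ) (X : unn n) : unn n :=
  ((traceForm n).toDual (traceForm_nondegenerate n)).symm (fderiv ℝ f X).toLinearMap

/-- The Lie-Poisson bracket `{f, h}(X) = ⟨X, [df(X), dh(X)]⟩` of `u(n,n) ≅ u(n,n)*`. -/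
def liePoisson (f h : unn n → ℝ) (X : unn n) : ℝ :=
  (Matrix.trace ((X : Mat2 n) *
    ((grad f X : Mat2 n) * (grad h X : Mat2 n) - (grad h X : Mat2 n) * (grad f X : Mat2 n)))).re

/-- `fα`, `fβ`, `fβ'`, `fδ` are the partial derivatives `∂f/∂α`, `∂f/∂β`, `∂f/∂β⁺`, `∂f/∂δ` at `X`
with respect to the blocks `α, δ ∈ iH(n)` and `β` of an element of `u(n,n)`. They are the gradients
for the trace pairing: `df = Tr(dα ∂f/∂α + dβ ∂f/∂β⁺ + dβ⁺ ∂f/∂β + dδ ∂f/∂δ)`, with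
`∂f/∂β⁺ = (∂f/∂β)⁺`. -/
structure IsPartials (f : unn n → ℝ) (X : unn n) (fα fβ fβ' fδ : Mat n) : Prop where
  memα : fα ∈ iH n
  memδ : fδ ∈ iH n
  adj : fβ' = fβᴴ
  deriv : ∀ (a : iH n) (b : Mat n) (d : iH n),
    (fderiv ℝ f X (ofBlocks a b d) : ℂ)
      = Matrix.trace ((a : Mat n) * fα + b * fβ' + bᴴ * fβ + (d : Mat n) * fδ)

end LiePoisson

end CotUn

end

/-! Everything is reduced to matrix algebra in the ambient spaces; the geometry enters through four
observations.

Graphs. On z = z^⊥ the two halves of a vector have equal norm, so projection to the lower half is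
injective on z, and by dimension z is the graph of a map T, which isotropy makes unitary. The
orthogonal projection onto the graph of Z has off-diagonal block Z/2 (`projMat_graph`), so Z depends
linearly on the embedded point of Gr₀. The condition 𝔛 = -φ𝔛⁺φ means 𝔛 ∈ u(n,n), and vanishing on
the graph of Z then expresses every block of 𝔛 through Z and the lower right block ρ
(`exists_J0_eq`). Hence I₀ is bijective, with a polynomial inverse in ambient coordinates.

Equivariance. Let G be the column (Z; 1). Then J₀ = -GρG⁺φ, and g maps G to G'(CZ+D), where G' is
the column of the transformed Z. As φg⁻¹ = g⁺φ, conjugating J₀ by g replaces Z by (AZ+B)(CZ+D)⁻¹ and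
ρ by (CZ+D)ρ(CZ+D)⁺ (`J0_equivariant`). The group laws of Λ are pulled back from Σ, while smoothness
of Σ is pushed forward from Λ.

Symplectic form. A tangent vector at (Z, ρ) is a pair (a, r) of anti-Hermitian matrices, with dZ =
Za and dρ = r. In these terms dγ₀ is Tr(r a' - r' a - ρ[a, a']) (`isExteriorDerivative_omega`).
Since Tr(a²) is negative definite on iH(n), this form is nondegenerate. Invariance of γ₀ under Λ
comes from (AZ+B)⁺A - (CZ+D)⁺C = Z⁺, a consequence of g⁺φg = φ.

Momentum and Poisson property. The generator of ξ is computed explicitly and compared with d Tr(J₀ξ)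
using only cyclicity of the trace and the adjoint relations (`isHamiltonianVector_momentum`). For
general f, the Hamiltonian vector of f ∘ J₀ at x is the generator of df(J₀(x)), so a bracket is the
derivative of Tr(J₀ξ) along the orbit of exp(tη). Equivariance makes it Tr([η, J₀]ξ) = Tr(J₀[ξ, η]).
The block formula is this trace multiplied out. -/

namespace CotUn

/-! ### Smooth maps and curves in embedded manifolds -/

section Smooth

variable {M N P E F G : Type*} [NormedAddCommGroup E] [NormedSpace ℝ E] [Embedded M E]
  [NormedAddCommGroup F] [NormedSpace ℝ F] [Embedded N F]
  [NormedAddCommGroup G] [NormedSpace ℝ G] [Embedded P G]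

theorem hasDerivAt_fst {f : ℝ → E × F} {f' : E × F} {t : ℝ} (h : HasDerivAt f f' t) :
    HasDerivAt (fun s => (f s).1) f'.1 t :=
  (ContinuousLinearMap.fst ℝ E F).hasFDerivAt.comp_hasDerivAt t h

theorem hasDerivAt_snd {f : ℝ → E × F} {f' : E × F} {t : ℝ} (h : HasDerivAt f f' t) :
    HasDerivAt (fun s => (f s).2) f'.2 t :=
  (ContinuousLinearMap.snd ℝ E F).hasFDerivAt.comp_hasDerivAt t h

theorem emb_injective : Function.Injective (emb : M → E) := Embedded.inj

theorem IsSmooth.of_contDiff {f : M → N} (g : E → F) (hg : ContDiff ℝ ∞ g)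
    (h : ∀ x, emb (f x) = g (emb x)) : IsSmooth f := fun _ =>
  ⟨Set.univ, isOpen_univ, Set.mem_univ _, g, hg.contDiffOn, fun y _ => (h y).symm⟩

theorem IsSmooth.comp {k : N → P} {f : M → N} (hk : IsSmooth k) (hf : IsSmooth f) :
    IsSmooth (k ∘ f) := by
  intro x
  obtain ⟨V, hV, hxV, a, ha, haf⟩ := hf x
  obtain ⟨W, hW, hxW, b, hb, hbk⟩ := hk (f x)
  refine ⟨V ∩ a ⁻¹' W, ha.continuousOn.isOpen_inter_preimage hV hW, ⟨hxV, ?_⟩, b ∘ a, ?_, ?_⟩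
  · rw [Set.mem_preimage, haf x hxV]; exact hxW
  · exact hb.comp (ha.mono Set.inter_subset_left) fun y hy => hy.2
  · rintro y ⟨hy, hy'⟩
    rw [Set.mem_preimage, haf y hy] at hy'
    rw [Function.comp_apply, haf y hy, hbk _ hy']
    rfl

/-- An ambient map `g'` that undoes `f` on its image makes `f` injective; by surjectivity that image
is all of `N`, so `g'` also represents the inverse. Each diffeomorphism below therefore needs only
an algebraic formula for recovering the point and a proof of surjectivity. -/
theorem IsDiffeo.of_surjective {f : M → N} (g : E → F) (g' : F → E) (hg : ContDiff ℝ ∞ g)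
    (hg' : ContDiff ℝ ∞ g') (h : ∀ x, emb (f x) = g (emb x)) (h' : ∀ x, g' (emb (f x)) = emb x)
    (hs : Function.Surjective f) : IsDiffeo f := by
  have hi : Function.Injective f := fun x y hxy => emb_injective <| by rw [← h', hxy, h']
  refine ⟨Function.surjInv hs, Function.leftInverse_surjInv ⟨hi, hs⟩,
    Function.rightInverse_surjInv hs, .of_contDiff g hg h, .of_contDiff g' hg' fun y => ?_⟩
  rw [← h' (Function.surjInv hs y), Function.surjInv_eq hs]

theorem IsSmooth.contDiff_curve {f : M → N} (hf : IsSmooth f) (c : SmoothCurve M) :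
    ContDiff ℝ ∞ (fun t => emb (f (c.toFun t))) := by
  refine contDiff_iff_contDiffAt.2 fun t => ?_
  obtain ⟨V, hV, hxV, g, hg, hgf⟩ := hf (c.toFun t)
  have h1 : ContDiffAt ℝ ∞ (fun t => g (emb (c.toFun t))) t :=
    (hg.contDiffAt (hV.mem_nhds hxV)).comp t c.smooth.contDiffAt
  refine h1.congr_of_eventuallyEq ?_
  filter_upwards [c.smooth.continuous.continuousAt.preimage_mem_nhds (hV.mem_nhds hxV)] with s hs
  exact (hgf _ hs).symm

/-- The image of a smooth curve under a smooth map. -/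
def SmoothCurve.map {f : M → N} (hf : IsSmooth f) (c : SmoothCurve M) : SmoothCurve N where
  toFun t := f (c.toFun t)
  smooth := hf.contDiff_curve c

theorem SmoothCurve.hasDerivAt (c : SmoothCurve M) (t : ℝ) :
    HasDerivAt (fun s => emb (c.toFun s)) (c.vel t : E) t :=
  (c.smooth.differentiable (by simp)).differentiableAt.hasDerivAt

end Smooth

/-! ### Differentiating matrix-valued functions -/

section MatrixCalculus

variable {n : ℕ} {E : Type*} [NormedAddCommGroup E] [NormedSpace ℝ E]

/-- Conjugate transposition as a continuous real-linear map. -/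
noncomputable def conjTransposeL (n : ℕ) : Mat n →L[ℝ] Mat n :=
  LinearMap.toContinuousLinearMap
    (Matrix.conjTransposeLinearEquiv (Fin n) (Fin n) ℝ ℂ).toLinearMap

theorem contDiff_conjTranspose {f : E → Mat n} (hf : ContDiff ℝ ∞ f) :
    ContDiff ℝ ∞ (fun x => (f x)ᴴ) := (conjTransposeL n).contDiff.comp hf

theorem hasDerivAt_conjTranspose {f : ℝ → Mat n} {f' : Mat n} {t : ℝ} (hf : HasDerivAt f f' t) :
    HasDerivAt (fun x => (f x)ᴴ) f'ᴴ t := (conjTransposeL n).hasFDerivAt.comp_hasDerivAt t hf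

/-- The real part of the trace as a continuous real-linear map. -/
noncomputable def reTraceL (ι : Type*) [Fintype ι] [DecidableEq ι] : Matrix ι ι ℂ →L[ℝ] ℝ :=
  LinearMap.toContinuousLinearMap (Complex.reLm ∘ₗ Matrix.traceLinearMap ι ℝ ℂ)

theorem hasDerivAt_re_trace {ι : Type*} [Fintype ι] [DecidableEq ι] {f : ℝ → Matrix ι ι ℂ}
    {f' : Matrix ι ι ℂ} {t : ℝ} (hf : HasDerivAt f f' t) :
    HasDerivAt (fun x => (Matrix.trace (f x)).re) (Matrix.trace f').re t :=
  (reTraceL ι).hasFDerivAt.comp_hasDerivAt t hf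

/-- The assembly of a matrix from its blocks as a continuous real-linear map. -/
noncomputable def fromBlocksL (n : ℕ) : (Mat n × Mat n) × (Mat n × Mat n) →L[ℝ] Mat2 n :=
  LinearMap.toContinuousLinearMap
    { toFun := fun p => Matrix.fromBlocks p.1.1 p.1.2 p.2.1 p.2.2
      map_add' := fun _ _ => (Matrix.fromBlocks_add _ _ _ _ _ _ _ _).symm
      map_smul' := fun _ _ => (Matrix.fromBlocks_smul _ _ _ _ _).symm }

theorem contDiff_fromBlocks {a b c d : E → Mat n} (ha : ContDiff ℝ ∞ a) (hb : ContDiff ℝ ∞ b)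
    (hc : ContDiff ℝ ∞ c) (hd : ContDiff ℝ ∞ d) :
    ContDiff ℝ ∞ (fun x => (Matrix.fromBlocks (a x) (b x) (c x) (d x) : Mat2 n)) :=
  (fromBlocksL n).contDiff.comp ((ha.prodMk hb).prodMk (hc.prodMk hd))

/-- The decomposition of a matrix into its blocks as a continuous real-linear map. -/
noncomputable def toBlocksL (n : ℕ) : Mat2 n →L[ℝ] (Mat n × Mat n) × (Mat n × Mat n) :=
  LinearMap.toContinuousLinearMap
    { toFun := fun X => ((X.toBlocks₁₁, X.toBlocks₁₂), (X.toBlocks₂₁, X.toBlocks₂₂))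
      map_add' := fun _ _ => rfl
      map_smul' := fun _ _ => rfl }

theorem contDiff_toBlocks {f : E → Mat2 n} (hf : ContDiff ℝ ∞ f) :
    ContDiff ℝ ∞ (fun x => (f x).toBlocks₁₁) ∧ ContDiff ℝ ∞ (fun x => (f x).toBlocks₁₂) ∧
    ContDiff ℝ ∞ (fun x => (f x).toBlocks₂₁) ∧ ContDiff ℝ ∞ (fun x => (f x).toBlocks₂₂) := by
  have h := (toBlocksL n).contDiff.comp hf
  exact ⟨h.fst.fst, h.fst.snd, h.snd.fst, h.snd.snd⟩

theorem hasDerivAt_toBlocks {f : ℝ → Mat2 n} {f' : Mat2 n} {t : ℝ} (hf : HasDerivAt f f' t) :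
    HasDerivAt (fun x => (f x).toBlocks₁₁) f'.toBlocks₁₁ t ∧
    HasDerivAt (fun x => (f x).toBlocks₁₂) f'.toBlocks₁₂ t ∧
    HasDerivAt (fun x => (f x).toBlocks₂₁) f'.toBlocks₂₁ t ∧
    HasDerivAt (fun x => (f x).toBlocks₂₂) f'.toBlocks₂₂ t := by
  have h := (toBlocksL n).hasFDerivAt.comp_hasDerivAt t hf
  exact ⟨hasDerivAt_fst (hasDerivAt_fst h), hasDerivAt_snd (hasDerivAt_fst h),
    hasDerivAt_fst (hasDerivAt_snd h), hasDerivAt_snd (hasDerivAt_snd h)⟩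

theorem contDiffAt_inv {a : Mat n} (ha : IsUnit a) :
    ContDiffAt ℝ ∞ (fun x : Mat n => x⁻¹) a := by
  obtain ⟨u, rfl⟩ := ha
  have h := contDiffAt_ringInverse ℝ (n := ∞) u
  refine h.congr_of_eventuallyEq (.of_forall fun x => ?_)
  exact Matrix.nonsing_inv_eq_ringInverse x

theorem contDiff_exp {ι : Type*} [Fintype ι] [DecidableEq ι] :
    ContDiff ℝ ∞ (NormedSpace.exp : Matrix ι ι ℂ → Matrix ι ι ℂ) :=
  contDiff_iff_contDiffAt.2 fun x => (NormedSpace.exp_analytic (𝕂 := ℝ) x).contDiffAt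

/-- The derivative of a quotient of matrix-valued functions. -/
theorem hasDerivAt_mul_inv {f g : ℝ → Mat n} {f' g' : Mat n} {t : ℝ} (hf : HasDerivAt f f' t)
    (hg : HasDerivAt g g' t) (hu : ∀ s, IsUnit (g s)) :
    HasDerivAt (fun s => f s * (g s)⁻¹) (f' * (g t)⁻¹ - f t * (g t)⁻¹ * g' * (g t)⁻¹) t := by
  -- Smoothness of inversion only provides some derivative `k` of g⁻¹; its value is then found by
  -- differentiating g g⁻¹ = 1.
  obtain ⟨k, hk⟩ : ∃ k, HasDerivAt (fun s => (g s)⁻¹) k t :=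
    ⟨_, (((contDiffAt_inv (hu t)).differentiableAt (by simp)).comp t
      hg.differentiableAt).hasDerivAt⟩
  have hdet := fun s => (Matrix.isUnit_iff_isUnit_det _).1 (hu s)
  have h1 := hg.mul hk
  have h2 : (g * fun s => (g s)⁻¹) = fun _ => 1 :=
    funext fun s => Matrix.mul_nonsing_inv _ (hdet s)
  rw [h2] at h1
  have h3 := h1.unique (hasDerivAt_const t (1 : Mat n))
  have h4 : k = -((g t)⁻¹ * g' * (g t)⁻¹) := by
    have := congrArg ((g t)⁻¹ * ·) h3
    simp only [mul_add, ← mul_assoc, Matrix.nonsing_inv_mul _ (hdet t), one_mul, mul_zero] at this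
    exact eq_neg_of_add_eq_zero_right this
  have h5 := hf.mul hk
  rw [h4] at h5
  refine h5.congr_deriv ?_
  rw [mul_neg, ← sub_eq_add_neg]
  simp only [mul_assoc]

end MatrixCalculus

/-! ### Reality and definiteness of traces -/

section Trace

variable {n : ℕ} {ι : Type*} [Fintype ι]

theorem re_trace_conjTranspose (a : Matrix ι ι ℂ) :
    (Matrix.trace aᴴ).re = (Matrix.trace a).re := by
  rw [Matrix.trace_conjTranspose]; simp

theorem ofReal_re_of_trace_conjTranspose {a : Matrix ι ι ℂ}
    (h : Matrix.trace aᴴ = Matrix.trace a) : ((Matrix.trace a).re : ℂ) = Matrix.trace a := by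
  rw [Matrix.trace_conjTranspose] at h
  exact Complex.conj_eq_iff_re.1 h

/-- (ab)⁺ = ba for anti-Hermitian a, b, so the trace equals its own conjugate. Taking real parts in
the definitions thus loses nothing. -/
theorem ofReal_re_trace_mul {a b : Mat n} (ha : a ∈ iH n) (hb : b ∈ iH n) :
    ((Matrix.trace (a * b)).re : ℂ) = Matrix.trace (a * b) := by
  refine ofReal_re_of_trace_conjTranspose ?_
  rw [Matrix.conjTranspose_mul, mem_iH.1 ha, mem_iH.1 hb, neg_mul_neg, Matrix.trace_mul_comm]

open scoped ComplexOrder in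
-- Here a² = -aa⁺, so the trace form is negative definite on iH(n). Injectivity of the
-- trivialization on fibres and nondegeneracy of dγ₀ both rest on this.
theorem eq_zero_of_re_trace_mul_self {a : Mat n} (ha : a ∈ iH n)
    (h : (Matrix.trace (a * a)).re = 0) : a = 0 := by
  have h1 : Matrix.trace (a * aᴴ) = 0 := by
    rw [mem_iH.1 ha, mul_neg, Matrix.trace_neg, ← ofReal_re_trace_mul ha ha, h]; simp
  exact Matrix.trace_mul_conjTranspose_self_eq_zero_iff.1 h1

/-- On u(n,n) one has X⁺ = -φXφ, hence (XY)⁺ = φ(YX)φ, which has the trace of XY because φ² = 1. -/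
theorem ofReal_re_trace_mul_unn {X Y : Mat2 n} (hX : X ∈ unn n) (hY : Y ∈ unn n) :
    ((Matrix.trace (X * Y)).re : ℂ) = Matrix.trace (X * Y) := by
  refine ofReal_re_of_trace_conjTranspose ?_
  have hφ := phi_mul_phi n
  have e : ∀ W ∈ unn n, Wᴴ = -(phi n * W * phi n) := fun W hW => by
    have := eq_neg_of_add_eq_zero_left (mem_unn.1 hW)
    rw [← neg_mul, ← this, mul_assoc, hφ, mul_one]
  rw [Matrix.conjTranspose_mul, e X hX, e Y hY, neg_mul_neg]
  calc _ = Matrix.trace (phi n * (Y * (phi n * phi n) * X * phi n)) := by simp only [mul_assoc]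
    _ = _ := by
      rw [Matrix.trace_mul_comm, hφ, mul_one, mul_assoc, hφ, mul_one, Matrix.trace_mul_comm]

theorem commutator_mem_unn {X Y : Mat2 n} (hX : X ∈ unn n) (hY : Y ∈ unn n) :
    X * Y - Y * X ∈ unn n := by
  have hx := eq_neg_of_add_eq_zero_left (mem_unn.1 hX)
  have hy := eq_neg_of_add_eq_zero_left (mem_unn.1 hY)
  rw [mem_unn, Matrix.conjTranspose_sub, Matrix.conjTranspose_mul, Matrix.conjTranspose_mul,
    sub_mul, mul_assoc, mul_assoc, hx, hy, mul_neg, mul_neg, ← mul_assoc, ← mul_assoc, hx, hy]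
  noncomm_ring

end Trace

variable {n : ℕ}

/-! ### The trivialization of the cotangent bundle -/

theorem emb_phase (x : Phase n) : emb x = ((x.1 : Mat n), (x.2 : Mat n)) := rfl

theorem leftPairing_apply (Z : U n) (ρ : iH n) (v : Mat n) :
    leftPairing Z ρ v = (Matrix.trace ((ρ : Mat n) * (Z : Mat n)ᴴ * v)).re := rfl

/-- The tangential part of v is (v - Zv⁺Z)/2, and the pairing changes sign under v ↦ Zv⁺Z. So the
formula Re Tr(ρZ⁺v) already vanishes on normal vectors and agrees with the extension by zero used to
embed T*U(n). -/
theorem leftPairing_tanProj (Z : U n) (ρ : iH n) (v : Mat n) :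
    leftPairing Z ρ (tanProj Z v) = leftPairing Z ρ v := by
  have h : (Matrix.trace ((ρ : Mat n) * (Z : Mat n)ᴴ * ((Z : Mat n) * vᴴ * (Z : Mat n)))).re
      = -(Matrix.trace ((ρ : Mat n) * (Z : Mat n)ᴴ * v)).re := by
    have e : (ρ : Mat n) * (Z : Mat n)ᴴ * ((Z : Mat n) * vᴴ * (Z : Mat n))
        = (ρ : Mat n) * vᴴ * (Z : Mat n) := by
      rw [mul_assoc (ρ : Mat n), ← mul_assoc (Z : Mat n)ᴴ, ← mul_assoc (Z : Mat n)ᴴ, U.star_mul,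
        one_mul, mul_assoc]
    rw [e, ← re_trace_conjTranspose, ← Complex.neg_re, ← Matrix.trace_neg,
      Matrix.conjTranspose_mul, Matrix.conjTranspose_mul, Matrix.conjTranspose_conjTranspose,
      mem_iH.1 ρ.2, mul_neg, mul_neg, ← mul_assoc, Matrix.trace_neg, Matrix.trace_neg,
      Matrix.trace_mul_comm, mul_assoc]
  change leftPairing Z ρ ((1 / 2 : ℝ) • (v - (Z : Mat n) * vᴴ * (Z : Mat n))) = _
  rw [map_smul, map_sub, leftPairing_apply, leftPairing_apply, h, smul_eq_mul]
  ring

/-- The coordinate matrix of v ↦ Re Tr(Mv) is M⁺. With M = ρZ⁺ and ρ⁺ = -ρ this is -Zρ. -/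
theorem emb_leftTriv (x : Phase n) :
    emb (leftTriv n x) = ((x.1 : Mat n), -((x.1 : Mat n) * (x.2 : Mat n))) := by
  refine Prod.ext rfl (Matrix.ext fun j k => ?_)
  have h1 : ∀ c : ℂ, (leftTriv n x).2.comp (tanProj x.1) (Matrix.single j k c)
      = ((((x.2 : Mat n) * (x.1 : Mat n)ᴴ) k j) * c).re := by
    intro c
    change leftPairing x.1 x.2 (tanProj x.1 (Matrix.single j k c)) = _
    rw [leftPairing_tanProj, leftPairing_apply, Matrix.trace_mul_single]
    rfl
  change ((((leftTriv n x).2.comp (tanProj x.1)) (Matrix.single j k 1) : ℝ) : ℂ) + Complex.I *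
    ((((leftTriv n x).2.comp (tanProj x.1)) (Matrix.single j k Complex.I) : ℝ) : ℂ) = _
  have h2 : -((x.1 : Mat n) * (x.2 : Mat n)) = ((x.2 : Mat n) * (x.1 : Mat n)ᴴ)ᴴ := by
    rw [Matrix.conjTranspose_mul, Matrix.conjTranspose_conjTranspose, mem_iH.1 x.2.2, mul_neg]
  rw [h1, h1, h2]
  change _ = star (((x.2 : Mat n) * (x.1 : Mat n)ᴴ) k j)
  apply Complex.ext <;> simp

/-- Left translation identifies `T_Z U(n)` with `iH(n)`. -/
noncomputable def tanEquiv (Z : U n) : Tan Z ≃ₗ[ℝ] iH n where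
  toFun v := ⟨(Z : Mat n)ᴴ * v, (mem_Tan_U Z v).1 v.2⟩
  map_add' v w := Subtype.ext (mul_add _ _ _)
  map_smul' r v := Subtype.ext (mul_smul_comm _ _ _)
  invFun a := ⟨(Z : Mat n) * a, (mem_Tan_U Z _).2 <| by
    rw [← mul_assoc, U.star_mul, one_mul]; exact a.2⟩
  left_inv v := Subtype.ext <| by
    change (Z : Mat n) * ((Z : Mat n)ᴴ * v) = v
    rw [← mul_assoc, U.mul_star, one_mul]
  right_inv a := Subtype.ext <| by
    change (Z : Mat n)ᴴ * ((Z : Mat n) * a) = a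
    rw [← mul_assoc, U.star_mul, one_mul]

theorem coe_tanEquiv_symm (Z : U n) (a : iH n) :
    ((tanEquiv Z).symm a : Mat n) = (Z : Mat n) * a := rfl

/-- The restriction of `leftTriv` to a fibre, as a linear map. -/
noncomputable def leftTrivFibre (Z : U n) : iH n →ₗ[ℝ] Module.Dual ℝ (Tan Z) where
  toFun ρ := (leftPairing Z ρ).domRestrict (Tan Z)
  map_add' ρ σ := LinearMap.ext fun v => by
    change leftPairing Z (ρ + σ) v = leftPairing Z ρ v + leftPairing Z σ v
    simp only [leftPairing_apply, Submodule.coe_add, add_mul, Matrix.trace_add, Complex.add_re]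
  map_smul' r ρ := LinearMap.ext fun v => by
    rw [RingHom.id_apply, LinearMap.smul_apply]
    change leftPairing Z (r • ρ) v = r • leftPairing Z ρ v
    rw [leftPairing_apply, leftPairing_apply, Submodule.coe_smul, smul_mul_assoc, smul_mul_assoc,
      Matrix.trace_smul, Complex.smul_re]

theorem leftTrivFibre_apply (Z : U n) (ρ : iH n) (v : Tan Z) :
    leftTrivFibre Z ρ v = leftPairing Z ρ (v : Mat n) := rfl

/-- Evaluating the covector of ρ on the tangent vector Zρ gives Tr(ρ²), so definiteness yields
injectivity; surjectivity follows by equality of dimensions. -/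
theorem leftTrivFibre_bijective (Z : U n) : Function.Bijective (leftTrivFibre Z) := by
  have hi : Function.Injective (leftTrivFibre Z) := by
    refine (injective_iff_map_eq_zero _).2 fun ρ h => Subtype.ext ?_
    have h2 : (ρ : Mat n) * (Z : Mat n)ᴴ * ((tanEquiv Z).symm ρ : Mat n) = (ρ : Mat n) * ρ := by
      rw [coe_tanEquiv_symm, mul_assoc, ← mul_assoc _ (Z : Mat n), U.star_mul, one_mul]
    refine eq_zero_of_re_trace_mul_self ρ.2 ?_
    rw [← h2, ← leftPairing_apply, ← leftTrivFibre_apply, h, LinearMap.zero_apply]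
  refine ⟨hi, (LinearMap.injective_iff_surjective_of_finrank_eq_finrank ?_).1 hi⟩
  rw [Subspace.dual_finrank_eq, (tanEquiv Z).finrank_eq]

theorem isDiffeo_leftTriv (n : ℕ) : IsDiffeo (leftTriv n) := by
  refine IsDiffeo.of_surjective (fun p => (p.1, -(p.1 * p.2))) (fun p => (p.1, -(p.1ᴴ * p.2)))
    ?_ ?_ emb_leftTriv ?_ ?_
  · exact contDiff_fst.prodMk (contDiff_fst.mul contDiff_snd).neg
  · exact contDiff_fst.prodMk ((contDiff_conjTranspose contDiff_fst).mul contDiff_snd).neg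
  · intro x
    rw [emb_leftTriv, emb_phase]
    simp only [mul_neg, neg_neg, ← mul_assoc, U.star_mul, one_mul]
  · rintro ⟨Z, p⟩
    obtain ⟨ρ, rfl⟩ := (leftTrivFibre_bijective Z).2 p
    exact ⟨(Z, ρ), rfl⟩

theorem ofReal_leftPairing (Z : U n) (ρ : iH n) (v : Tan Z) : ((leftPairing Z ρ v : ℝ) : ℂ) =
    Matrix.trace ((ρ : Mat n) * (Z : Mat n)ᴴ * (v : Mat n)) := by
  rw [leftPairing_apply, mul_assoc]
  exact ofReal_re_trace_mul ρ.2 ((mem_Tan_U Z v).1 v.2)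

/-! ### The isotropic Grassmannian -/

/-- The matrix whose first `n` columns span the graph of `Z`, the other columns being zero. -/
def graphMat (Z : Mat n) : Mat2 n := Matrix.fromBlocks Z 0 1 0

theorem graphMat_mulVec (Z : Mat n) (ξ : Fin n → ℂ) :
    graphMat Z *ᵥ Sum.elim ξ 0 = Sum.elim (Z *ᵥ ξ) ξ := by
  rw [graphMat, Matrix.fromBlocks_mulVec]
  simp

/-- The residual of the claimed projection has the form (u, -Z⁺u), which is orthogonal to every (Zξ,
ξ). The formula shows that Z is twice the upper right block, which supplies the smooth inverse of Z
↦ graph of Z. -/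
theorem projMat_graph (Z : U n) :
    projMat (graph Z) = (1 / 2 : ℝ) • Matrix.fromBlocks 1 (Z : Mat n) (Z : Mat n)ᴴ 1 := by
  rw [← LinearMap.toMatrix'_toLin' ((1 / 2 : ℝ) • Matrix.fromBlocks 1 (Z : Mat n) (Z : Mat n)ᴴ 1)]
  refine congrArg LinearMap.toMatrix' (LinearMap.ext fun v => ?_)
  rw [Matrix.toLin'_apply]
  set w := ((1 / 2 : ℝ) • Matrix.fromBlocks 1 (Z : Mat n) (Z : Mat n)ᴴ 1 : Mat2 n) *ᵥ v with hw
  have hwe : w = (1 / 2 : ℂ) • Sum.elim (v ∘ Sum.inl + (Z : Mat n) *ᵥ (v ∘ Sum.inr))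
      ((Z : Mat n)ᴴ *ᵥ (v ∘ Sum.inl) + v ∘ Sum.inr) := by
    rw [hw, Matrix.smul_mulVec, Matrix.fromBlocks_mulVec, Matrix.one_mulVec, Matrix.one_mulVec]
    ext i; simp [Complex.real_smul]
  change WithLp.ofLp ((Submodule.map (WithLp.linearEquiv 2 ℂ (Vec2 n)).symm.toLinearMap
    (graph Z)).starProjection (WithLp.toLp 2 v)) = w
  suffices h : (Submodule.map (WithLp.linearEquiv 2 ℂ (Vec2 n)).symm.toLinearMap
      (graph Z)).starProjection (WithLp.toLp 2 v) = WithLp.toLp 2 w by rw [h]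
  refine Submodule.eq_starProjection_of_mem_of_inner_eq_zero ?_ ?_
  · refine ⟨w, ⟨(1 / 2 : ℂ) • ((Z : Mat n)ᴴ *ᵥ (v ∘ Sum.inl) + v ∘ Sum.inr), ?_⟩, rfl⟩
    rw [hwe, Matrix.mulVec_smul, Matrix.mulVec_add, Matrix.mulVec_mulVec, U.mul_star,
      Matrix.one_mulVec]
    ext (i | i) <;> simp <;> ring
  · rintro _ ⟨_, ⟨ξ, rfl⟩, rfl⟩
    change inner ℂ (WithLp.toLp 2 (v - w)) (WithLp.toLp 2 (Sum.elim ((Z : Mat n) *ᵥ ξ) ξ)) = 0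
    rw [EuclideanSpace.inner_toLp_toLp]
    -- The residual is written as (u, -Z⁺u) with u = (v₁ - Zv₂)/2, where v₁ and v₂ are the halves of
    -- v.
    have hd : v - w = Sum.elim ((1 / 2 : ℂ) • (v ∘ Sum.inl - (Z : Mat n) *ᵥ (v ∘ Sum.inr)))
        (-((Z : Mat n)ᴴ *ᵥ ((1 / 2 : ℂ) • (v ∘ Sum.inl - (Z : Mat n) *ᵥ (v ∘ Sum.inr))))) := by
      rw [hwe, Matrix.mulVec_smul, Matrix.mulVec_sub, Matrix.mulVec_mulVec, U.star_mul,
        Matrix.one_mulVec]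
      ext (i | i) <;> simp <;> ring
    set u := (1 / 2 : ℂ) • (v ∘ Sum.inl - (Z : Mat n) *ᵥ (v ∘ Sum.inr))
    have hs : star (v - w) = Sum.elim (star u) (-(star u ᵥ* (Z : Mat n))) := by
      rw [hd]
      have : star ((Z : Mat n)ᴴ *ᵥ u) = star u ᵥ* (Z : Mat n) := by
        rw [Matrix.star_mulVec, Matrix.conjTranspose_conjTranspose]
      rw [← this]
      ext (i | i) <;> simp
    rw [dotProduct_comm, hs, sumElim_dotProduct_sumElim, neg_dotProduct, Matrix.dotProduct_mulVec,
      add_neg_cancel]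

theorem star_dotProduct_phi (v w : Vec2 n) : star v ⬝ᵥ (phi n *ᵥ w)
    = star (v ∘ Sum.inl) ⬝ᵥ (w ∘ Sum.inl) - star (v ∘ Sum.inr) ⬝ᵥ (w ∘ Sum.inr) := by
  rw [phi, Matrix.fromBlocks_mulVec]
  simp only [dotProduct, Fintype.sum_sum_type, Sum.elim_inl, Sum.elim_inr, Matrix.one_mulVec,
    Matrix.zero_mulVec, Matrix.neg_mulVec, add_zero, zero_add, Pi.neg_apply, mul_neg,
    Finset.sum_neg_distrib, sub_eq_add_neg]
  rfl

open scoped ComplexOrder in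
/-- Every isotropic subspace of dimension `n` is the graph of a unitary matrix. -/
theorem I0base_surjective (n : ℕ) : Function.Surjective (I0base (n := n)) := by
  rintro ⟨⟨z, hz⟩, hp⟩
  -- The inclusion z ⊂ z^⊥, written out in the two halves of ℂ^{2n}.
  have hiso : ∀ v ∈ z, ∀ w ∈ z, star (v ∘ Sum.inl) ⬝ᵥ (w ∘ Sum.inl)
      = star (v ∘ Sum.inr) ⬝ᵥ (w ∘ Sum.inr) := by
    intro v hv w hw
    change perp z = z at hp
    rw [← hp] at hw
    rw [← sub_eq_zero, ← star_dotProduct_phi]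
    exact hw v hv
  let q : z →ₗ[ℂ] (Fin n → ℂ) :=
    { toFun := fun v => v.1 ∘ Sum.inr
      map_add' := fun _ _ => rfl
      map_smul' := fun _ _ => rfl }
  -- If the lower half of v ∈ z vanishes, isotropy makes the norm of the upper half zero as well.
  have hqi : Function.Injective q := by
    refine (injective_iff_map_eq_zero q).2 fun v hv => Subtype.ext ?_
    have h2 : v.1 ∘ Sum.inr = 0 := hv
    have h1 : v.1 ∘ Sum.inl = 0 := by
      rw [← dotProduct_self_star_eq_zero, dotProduct_comm, hiso v v.2 v v.2, h2, dotProduct_zero]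
    ext (i | i)
    · exact congrFun h1 i
    · exact congrFun h2 i
  let e : z ≃ₗ[ℂ] (Fin n → ℂ) := LinearEquiv.ofInjectiveOfFinrankEq q hqi (by
    rw [hz, Module.finrank_fin_fun])
  have heq : ∀ ξ, (e.symm ξ : Vec2 n) ∘ Sum.inr = ξ := fun ξ => e.apply_symm_apply ξ
  let T : (Fin n → ℂ) →ₗ[ℂ] (Fin n → ℂ) :=
    { toFun := fun ξ => (e.symm ξ : Vec2 n) ∘ Sum.inl
      map_add' := fun ξ η => by rw [map_add]; rfl
      map_smul' := fun r ξ => by rw [map_smul]; rfl }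
  have hT : ∀ ξ, LinearMap.toMatrix' T *ᵥ ξ = (e.symm ξ : Vec2 n) ∘ Sum.inl := fun ξ => by
    rw [LinearMap.toMatrix'_mulVec]; rfl
  -- Isotropy of the vectors (Tξ, ξ) says ⟨Tξ, Tη⟩ = ⟨ξ, η⟩, that is T⁺T = 1. It is tested with η a
  -- basis vector and ξ = `star w` arbitrary.
  have hU : LinearMap.toMatrix' T ∈ Matrix.unitaryGroup (Fin n) ℂ := by
    rw [Matrix.mem_unitaryGroup_iff', Matrix.star_eq_conjTranspose]
    refine Matrix.ext_of_mulVec_single fun i => ?_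
    refine dotProduct_eq _ _ fun w => ?_
    have := hiso _ (e.symm (star w)).2 _ (e.symm (Pi.single i 1)).2
    rw [heq, heq, ← hT, ← hT, star_star] at this
    rw [Matrix.one_mulVec, ← Matrix.mulVec_mulVec, dotProduct_comm, dotProduct_comm _ w, ← this,
      Matrix.star_mulVec, star_star, ← Matrix.dotProduct_mulVec]
  refine ⟨⟨_, hU⟩, Subtype.ext (Subtype.ext ?_)⟩
  change graph _ = z
  refine Submodule.eq_of_le_of_finrank_eq ?_ ((finrank_graph _).trans hz.symm)
  rintro _ ⟨ξ, rfl⟩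
  change Sum.elim (LinearMap.toMatrix' T *ᵥ ξ) ξ ∈ z
  rw [hT]
  nth_rw 2 [← heq ξ]
  rw [Sum.elim_comp_inl_inr]
  exact (e.symm ξ).2

theorem isDiffeo_I0base (n : ℕ) : IsDiffeo (I0base (n := n)) := by
  refine IsDiffeo.of_surjective
    (fun Z => (1 / 2 : ℝ) • (Matrix.fromBlocks 1 Z Zᴴ 1 : Mat2 n)) (fun P => (2 : ℝ) • P.toBlocks₁₂)
    ?_ ?_ projMat_graph ?_ (I0base_surjective n)
  · exact (contDiff_fromBlocks contDiff_const contDiff_id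
      (contDiff_conjTranspose contDiff_id) contDiff_const).const_smul _
  · exact (contDiff_toBlocks contDiff_id).2.1.const_smul _
  · intro Z
    change (2 : ℝ) • (projMat (graph Z)).toBlocks₁₂ = Z
    rw [projMat_graph, Matrix.fromBlocks_smul, Matrix.toBlocks_fromBlocks₁₂, smul_smul]
    norm_num

/-! ### The bundle `N₀` -/

theorem mem_unn_of_inv_eq {X : Mat2 n} (h : inv X = X) : X ∈ unn n := by
  rw [mem_unn]
  nth_rw 2 [← h]
  rw [inv, mul_neg, ← mul_assoc, ← mul_assoc, phi_mul_phi, one_mul, add_neg_cancel]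

theorem exists_ofBlocks_eq {X : Mat2 n} (hX : X ∈ unn n) :
    ∃ (α : iH n) (β : Mat n) (δ : iH n), (ofBlocks α β δ : Mat2 n) = X := by
  have h := mem_unn.1 hX
  rw [phi, ← Matrix.fromBlocks_toBlocks X, Matrix.fromBlocks_conjTranspose,
    Matrix.fromBlocks_multiply, Matrix.fromBlocks_multiply, Matrix.fromBlocks_add,
    ← Matrix.fromBlocks_zero, Matrix.fromBlocks_inj] at h
  simp only [mul_one, mul_zero, add_zero, zero_add, mul_neg, neg_mul, one_mul, zero_mul] at h
  obtain ⟨h1, h2, h3, h4⟩ := h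
  refine ⟨⟨X.toBlocks₁₁, eq_neg_of_add_eq_zero_left h1⟩, X.toBlocks₁₂, ⟨X.toBlocks₂₂, ?_⟩, ?_⟩
  · rw [← neg_add, neg_eq_zero] at h4
    exact eq_neg_of_add_eq_zero_left h4
  · rw [← sub_eq_add_neg, sub_eq_zero] at h3
    change Matrix.fromBlocks _ _ _ _ = X
    rw [h3, Matrix.fromBlocks_toBlocks]

/-- Vanishing on the vectors (Zξ, ξ) means αZ + β = 0 and β⁺Z + δ = 0. As Z is unitary and δ
anti-Hermitian, the second equation gives β = Zδ and the first then α = -ZδZ⁺, so ρ = δ. -/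
theorem exists_J0_eq (Z : U n) {X : Mat2 n} (hX : MemN (X, (I0base Z).1)) (hi : inv X = X) :
    ∃ ρ : iH n, (J0 (Z, ρ) : Mat2 n) = X := by
  obtain ⟨α, β, δ, rfl⟩ := exists_ofBlocks_eq (mem_unn_of_inv_eq hi)
  have hk : ∀ ξ : Fin n → ℂ,
      (ofBlocks α β δ : Mat2 n) *ᵥ Sum.elim ((Z : Mat n) *ᵥ ξ) ξ = 0 := fun ξ => hX.2 ⟨ξ, rfl⟩
  have h0 : (α : Mat n) * (Z : Mat n) + β = 0 ∧ βᴴ * (Z : Mat n) + (δ : Mat n) = 0 := by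
    have : ∀ ξ, ((α : Mat n) * (Z : Mat n) + β) *ᵥ ξ = 0 ∧
        (βᴴ * (Z : Mat n) + (δ : Mat n)) *ᵥ ξ = 0 := fun ξ => by
      have := hk ξ
      rw [ofBlocks, Matrix.fromBlocks_mulVec, Sum.elim_comp_inl, Sum.elim_comp_inr,
        Matrix.mulVec_mulVec, Matrix.mulVec_mulVec, ← Matrix.add_mulVec,
        ← Matrix.add_mulVec] at this
      exact ⟨funext fun i => congrFun this (Sum.inl i), funext fun i => congrFun this (Sum.inr i)⟩
    constructor
    · exact Matrix.ext_of_mulVec_single fun i =>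
      (this _).1.trans (Matrix.zero_mulVec _).symm
    · exact Matrix.ext_of_mulVec_single fun i =>
      (this _).2.trans (Matrix.zero_mulVec _).symm
  have hβ : β = (Z : Mat n) * (δ : Mat n) := by
    have h1 : βᴴ = -((δ : Mat n) * (Z : Mat n)ᴴ) := by
      calc βᴴ = βᴴ * (Z : Mat n) * (Z : Mat n)ᴴ := by rw [mul_assoc, U.mul_star, mul_one]
        _ = _ := by rw [eq_neg_of_add_eq_zero_left h0.2, neg_mul]
    rw [← Matrix.conjTranspose_conjTranspose β, h1, Matrix.conjTranspose_neg,
      Matrix.conjTranspose_mul, Matrix.conjTranspose_conjTranspose, mem_iH.1 δ.2, mul_neg, neg_neg]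
  have hα : (α : Mat n) = -((Z : Mat n) * δ * (Z : Mat n)ᴴ) := by
    calc (α : Mat n) = α * (Z : Mat n) * (Z : Mat n)ᴴ := by rw [mul_assoc, U.mul_star, mul_one]
      _ = _ := by rw [eq_neg_of_add_eq_zero_left h0.1, neg_mul, hβ]
  refine ⟨δ, ?_⟩
  change Matrix.fromBlocks (-((Z : Mat n) * (δ : Mat n) * (Z : Mat n)ᴴ)) ((Z : Mat n) * (δ : Mat n))
    ((Z : Mat n) * (δ : Mat n))ᴴ (δ : Mat n) = Matrix.fromBlocks (α : Mat n) β βᴴ (δ : Mat n)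
  rw [← hα, ← hβ]

theorem I0_surjective (n : ℕ) : Function.Surjective (I0 (n := n)) := by
  rintro ⟨⟨X, z⟩, hm, hi, hp⟩
  obtain ⟨Z, hZ⟩ := I0base_surjective n ⟨z, hp⟩
  obtain rfl : (I0base Z).1 = z := congrArg Subtype.val hZ
  obtain ⟨ρ, hρ⟩ := exists_J0_eq Z hm hi
  exact ⟨(Z, ρ), Subtype.ext (Prod.ext hρ rfl)⟩

/-- The matrix `J₀(Z, ρ)` as a function on the ambient space. -/
def J0Mat (p : Mat n × Mat n) : Mat2 n :=
  Matrix.fromBlocks (-(p.1 * p.2 * p.1ᴴ)) (p.1 * p.2) (p.1 * p.2)ᴴ p.2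

theorem coe_J0 (x : Phase n) : (J0 x : Mat2 n) = J0Mat (emb x) := rfl

theorem contDiff_J0Mat : ContDiff ℝ ∞ (J0Mat (n := n)) :=
  contDiff_fromBlocks
    ((contDiff_fst.mul contDiff_snd).mul (contDiff_conjTranspose contDiff_fst)).neg
    (contDiff_fst.mul contDiff_snd) (contDiff_conjTranspose (contDiff_fst.mul contDiff_snd))
    contDiff_snd

theorem isSmooth_J0 (n : ℕ) : IsSmooth (J0 (n := n)) := .of_contDiff J0Mat contDiff_J0Mat coe_J0

theorem isDiffeo_I0 (n : ℕ) : IsDiffeo (I0 (n := n)) := by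
  refine IsDiffeo.of_surjective
    (fun p => (J0Mat p, (1 / 2 : ℝ) • (Matrix.fromBlocks 1 p.1 p.1ᴴ 1 : Mat2 n)))
    -- Z is read off the projection onto z, and ρ is the lower right block of 𝔛.
    (fun p => ((2 : ℝ) • p.2.toBlocks₁₂, p.1.toBlocks₂₂))
    ?_ ?_ ?_ ?_ (I0_surjective n)
  · exact contDiff_J0Mat.prodMk ((contDiff_fromBlocks contDiff_const
      contDiff_fst (contDiff_conjTranspose contDiff_fst) contDiff_const).const_smul _)
  · exact ((contDiff_toBlocks contDiff_snd).2.1.const_smul _).prodMk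
      (contDiff_toBlocks contDiff_fst).2.2.2
  · exact fun x => Prod.ext rfl (projMat_graph x.1)
  · intro x
    change ((2 : ℝ) • (projMat (graph x.1)).toBlocks₁₂, _) = _
    rw [projMat_graph, Matrix.fromBlocks_smul, Matrix.toBlocks_fromBlocks₁₂, smul_smul]
    refine Prod.ext ?_ rfl
    change ((2 : ℝ) * (1 / 2)) • (x.1 : Mat n) = x.1
    norm_num

/-- The restriction of `I₀` to a fibre, as a linear map. -/
noncomputable def I0Fibre (Z : U n) : iH n →ₗ[ℝ] N0.fibre (I0base Z) where
  toFun ρ := ⟨J0 (Z, ρ), (I0 (Z, ρ)).2.1, (I0 (Z, ρ)).2.2.1⟩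
  map_add' ρ σ := Subtype.ext <| by
    change J0Mat ((Z : Mat n), (ρ : Mat n) + σ) =
      J0Mat ((Z : Mat n), (ρ : Mat n)) + J0Mat ((Z : Mat n), (σ : Mat n))
    simp only [J0Mat, Matrix.fromBlocks_add, mul_add, add_mul, neg_add, Matrix.conjTranspose_add]
  map_smul' r ρ := Subtype.ext <| by
    rw [RingHom.id_apply]
    change J0Mat ((Z : Mat n), r • (ρ : Mat n)) = r • J0Mat ((Z : Mat n), (ρ : Mat n))
    simp only [J0Mat, Matrix.fromBlocks_smul, mul_smul_comm, smul_mul_assoc, smul_neg,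
      Matrix.conjTranspose_smul, star_trivial]

theorem I0Fibre_bijective (Z : U n) : Function.Bijective (I0Fibre Z) := by
  constructor
  · intro ρ σ h
    have h1 : J0Mat ((Z : Mat n), (ρ : Mat n)) = J0Mat ((Z : Mat n), (σ : Mat n)) :=
      congrArg Subtype.val h
    exact Subtype.ext (Matrix.fromBlocks_inj.1 h1).2.2.2
  · rintro ⟨X, hm, hi⟩
    obtain ⟨ρ, hρ⟩ := exists_J0_eq Z hm hi
    exact ⟨ρ, Subtype.ext hρ⟩

/-! ### Equivariance -/

/-- The matrix with upper left block `a`, the other blocks being zero. -/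
def corner (a : Mat n) : Mat2 n := Matrix.fromBlocks a 0 0 0

/-- The factorization J₀ = -GρG⁺φ with G = (Z; 1), padded by zeros so that all factors are square of
size 2n. It isolates the dependence on Z in a factor on which g acts by left multiplication. -/
theorem coe_J0_eq_graphMat (x : Phase n) : (J0 x : Mat2 n)
    = -(graphMat (x.1 : Mat n) * corner (x.2 : Mat n) * (graphMat (x.1 : Mat n))ᴴ * phi n) := by
  rw [coe_J0, J0Mat, graphMat, corner, phi, emb_phase]
  simp [Matrix.fromBlocks_conjTranspose, Matrix.fromBlocks_multiply, Matrix.fromBlocks_neg,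
    mem_iH.1 x.2.2]

/-- Homogeneous coordinates for the fractional linear action: g(Z; 1) = (AZ+B; CZ+D), and CZ+D
factors out on the right. Both the action on subspaces and the conjugation of J₀ follow from this
identity. -/
theorem mat_mul_graphMat (g : Unn n) (x : Phase n) :
    g.mat * graphMat (x.1 : Mat n) = graphMat ((Lam g x).1 : Mat n) * corner (denom g x.1) := by
  have hd := (Matrix.isUnit_iff_isUnit_det _).1 (denom_isUnit g x.1)
  have h : ((Lam g x).1 : Mat n) * denom g x.1 = numer g x.1 := by
    change numer g x.1 * (denom g x.1)⁻¹ * denom g x.1 = _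
    rw [mul_assoc, Matrix.nonsing_inv_mul _ hd, mul_one]
  rw [graphMat, graphMat, corner, ← Matrix.fromBlocks_toBlocks g.mat, Matrix.fromBlocks_multiply,
    Matrix.fromBlocks_multiply, h]
  simp [numer, denom]

/-- Since φg⁻¹ = g⁺φ, conjugation turns -GρG⁺φ into -(gG)ρ(gG)⁺φ. The factor CZ+D of gG is absorbed
into ρ, producing (CZ+D)ρ(CZ+D)⁺. -/
theorem J0_equivariant (g : Unn n) (x : Phase n) :
    g.mat * (J0 x : Mat2 n) * (g⁻¹).mat = J0 (Lam g x) := by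
  have h1 : phi n * (g⁻¹).mat = g.matᴴ * phi n := by
    rw [g.inv_mat, ← mul_assoc, ← mul_assoc, phi_mul_phi, one_mul]
  have h2 := mat_mul_graphMat g x
  have h3 : corner ((Lam g x).2 : Mat n)
      = corner (denom g x.1) * corner (x.2 : Mat n) * (corner (denom g x.1))ᴴ := by
    change corner (denom g x.1 * (x.2 : Mat n) * (denom g x.1)ᴴ) = _
    simp [corner, Matrix.fromBlocks_conjTranspose, Matrix.fromBlocks_multiply]
  rw [coe_J0_eq_graphMat, coe_J0_eq_graphMat, h3]
  calc _ = -((g.mat * graphMat (x.1 : Mat n)) * corner (x.2 : Mat n) * (graphMat (x.1 : Mat n))ᴴ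
          * (phi n * (g⁻¹).mat)) := by simp only [mul_assoc, neg_mul, mul_neg]
    _ = -((g.mat * graphMat (x.1 : Mat n)) * corner (x.2 : Mat n)
          * (g.mat * graphMat (x.1 : Mat n))ᴴ * phi n) := by
        rw [h1, Matrix.conjTranspose_mul]; simp only [mul_assoc]
    _ = _ := by
        rw [h2, Matrix.conjTranspose_mul]; simp only [mul_assoc]

theorem map_graph (g : Unn n) (x : Phase n) :
    (graph x.1).map g.equiv.toLinearMap = graph (Lam g x).1 := by
  refine Submodule.eq_of_le_of_finrank_eq ?_ ?_
  · rintro _ ⟨_, ⟨ξ, rfl⟩, rfl⟩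
    refine ⟨denom g x.1 *ᵥ ξ, ?_⟩
    change _ = g.mat *ᵥ _
    have h : corner (denom g x.1) *ᵥ Sum.elim ξ 0 = Sum.elim (denom g x.1 *ᵥ ξ) 0 := by
      rw [corner, Matrix.fromBlocks_mulVec]; simp
    rw [← graphMat_mulVec, ← graphMat_mulVec, Matrix.mulVec_mulVec, mat_mul_graphMat,
      ← Matrix.mulVec_mulVec, h]
  · rw [finrank_graph]
    exact (g.equiv.finrank_map_eq _).trans (finrank_graph x.1)

theorem I0_Lam (g : Unn n) (x : Phase n) : I0 (Lam g x) = Sig g (I0 x) :=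
  Subtype.ext (Prod.ext (J0_equivariant g x).symm (Subtype.ext (map_graph g x).symm))

theorem Unn.mat_one : (1 : Unn n).mat = 1 := rfl

theorem Unn.mat_mul (g h : Unn n) : (g * h).mat = g.mat * h.mat := rfl

theorem Sig_one (p : N0 n) : Sig 1 p = p := by
  refine Subtype.ext (Prod.ext ?_ (Subtype.ext ?_))
  · change (1 : Unn n).mat * p.1.1 * (1⁻¹ : Unn n).mat = p.1.1
    rw [inv_one, Unn.mat_one, one_mul, mul_one]
  · change p.1.2.1.map _ = p.1.2.1
    have : (1 : Unn n).equiv.toLinearMap = LinearMap.id := Matrix.mulVecLin_one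
    rw [this, Submodule.map_id]

theorem Sig_mul (g h : Unn n) (p : N0 n) : Sig (g * h) p = Sig g (Sig h p) := by
  refine Subtype.ext (Prod.ext ?_ (Subtype.ext ?_))
  · change (g * h).mat * p.1.1 * ((g * h)⁻¹).mat = g.mat * (h.mat * p.1.1 * (h⁻¹).mat) * (g⁻¹).mat
    rw [mul_inv_rev, Unn.mat_mul, Unn.mat_mul]
    simp only [mul_assoc]
  · change p.1.2.1.map _ = (p.1.2.1.map _).map _
    have : (g * h).equiv.toLinearMap = g.equiv.toLinearMap ∘ₗ h.equiv.toLinearMap :=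
      Matrix.mulVecLin_mul _ _
    rw [this, Submodule.map_comp]

theorem I0_injective (n : ℕ) : Function.Injective (I0 (n := n)) :=
  let ⟨_, h, _⟩ := isDiffeo_I0 n
  h.injective

/-- The laws for Λ are transported from Σ through the injective map I₀, so no fractional linear
transformations have to be composed. -/
theorem Lam_one (x : Phase n) : Lam 1 x = x := I0_injective n (by rw [I0_Lam, Sig_one])

theorem Lam_mul (g h : Unn n) (x : Phase n) : Lam (g * h) x = Lam g (Lam h x) :=
  I0_injective n (by rw [I0_Lam, I0_Lam, I0_Lam, Sig_mul])

theorem isSmooth_Lam (g : Unn n) : IsSmooth (Lam g) := by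
  set a : Mat n × Mat n → Mat n := fun p => g.mat.toBlocks₁₁ * p.1 + g.mat.toBlocks₁₂
  set d : Mat n × Mat n → Mat n := fun p => g.mat.toBlocks₂₁ * p.1 + g.mat.toBlocks₂₂
  have ha : ContDiff ℝ ∞ a := (contDiff_const.mul contDiff_fst).add contDiff_const
  have hd : ContDiff ℝ ∞ d := (contDiff_const.mul contDiff_fst).add contDiff_const
  intro x
  -- The extension of Λ_g to ambient matrices is smooth on the open set where CZ+D is invertible,
  -- which contains all of U(n) × iH(n).
  refine ⟨d ⁻¹' {u | IsUnit u}, Units.isOpen.preimage hd.continuous, denom_isUnit g x.1,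
    fun p => (a p * (d p)⁻¹, d p * p.2 * (d p)ᴴ), ?_, fun _ _ => rfl⟩
  refine ContDiffOn.prodMk ?_
    ((hd.mul contDiff_snd).mul (contDiff_conjTranspose hd)).contDiffOn
  exact ha.contDiffOn.mul fun p hp =>
    ((contDiffAt_inv hp).comp p hd.contDiffAt).contDiffWithinAt

/-- Σ_g is conjugate to Λ_g by the diffeomorphism I₀; this avoids describing the orthogonal
projection onto gz. -/
theorem isSmooth_Sig (g : Unn n) : IsSmooth (Sig g) := by
  obtain ⟨k, -, hk, hI, hks⟩ := isDiffeo_I0 n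
  have h : Sig g = I0 ∘ Lam g ∘ k := funext fun p => by
    rw [Function.comp_apply, Function.comp_apply, I0_Lam, hk]
  rw [h]
  exact hI.comp ((isSmooth_Lam g).comp hks)

/-! ### Partial derivatives of functions of two real variables -/

section Partial

variable {E : Type*} [NormedAddCommGroup E] [NormedSpace ℝ E] {F : ℝ × ℝ → E}

theorem hasDerivAt_partial_fst (hF : ContDiff ℝ ∞ F) (s t : ℝ) :
    HasDerivAt (fun s => F (s, t)) (fderiv ℝ F (s, t) (1, 0)) s :=
  (hF.differentiable (by simp) (s, t)).hasFDerivAt.comp_hasDerivAt s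
    ((hasDerivAt_id s).prodMk (hasDerivAt_const s t))

theorem hasDerivAt_partial_snd (hF : ContDiff ℝ ∞ F) (s t : ℝ) :
    HasDerivAt (fun t => F (s, t)) (fderiv ℝ F (s, t) (0, 1)) t :=
  (hF.differentiable (by simp) (s, t)).hasFDerivAt.comp_hasDerivAt t
    ((hasDerivAt_const t s).prodMk (hasDerivAt_id t))

/-- A smooth function of two variables has partial derivatives, and its mixed second partial
derivatives agree. -/
theorem exists_partials (hF : ContDiff ℝ ∞ F) : ∃ F₁ F₂ : ℝ → ℝ → E,
    (∀ s t, HasDerivAt (fun s => F (s, t)) (F₁ s t) s) ∧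
    (∀ s t, HasDerivAt (fun t => F (s, t)) (F₂ s t) t) ∧
    ∀ s t, ∃ m : E, HasDerivAt (fun s => F₂ s t) m s ∧ HasDerivAt (fun t => F₁ s t) m t := by
  have h1 : ContDiff ℝ ∞ (fderiv ℝ F) := hF.fderiv_right (by simp)
  refine ⟨fun s t => fderiv ℝ F (s, t) (1, 0), fun s t => fderiv ℝ F (s, t) (0, 1),
    hasDerivAt_partial_fst hF, hasDerivAt_partial_snd hF, fun s t => ?_⟩
  have hs : IsSymmSndFDerivAt ℝ F (s, t) := hF.contDiffAt.isSymmSndFDerivAt (by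
    rw [minSmoothness_of_isRCLikeNormedField]; exact WithTop.coe_le_coe.2 le_top)
  refine ⟨fderiv ℝ (fderiv ℝ F) (s, t) (1, 0) (0, 1), ?_, ?_⟩
  · exact (hasDerivAt_partial_fst h1 s t).clm_apply (hasDerivAt_const s (0, 1)) |>.congr_deriv
      (by simp)
  · rw [hs.eq]
    exact (hasDerivAt_partial_snd h1 s t).clm_apply (hasDerivAt_const t (1, 0)) |>.congr_deriv
      (by simp)

end Partial

/-! ### Tangent vectors of `U(n) × iH(n)` -/

theorem SmoothCurve.hasDerivAt_phase (c : SmoothCurve (Phase n)) (t : ℝ) :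
    HasDerivAt (fun s => ((c.toFun s).1 : Mat n)) (c.vel t : Mat n × Mat n).1 t ∧
    HasDerivAt (fun s => ((c.toFun s).2 : Mat n)) (c.vel t : Mat n × Mat n).2 t :=
  ⟨hasDerivAt_fst (c.hasDerivAt t), hasDerivAt_snd (c.hasDerivAt t)⟩

theorem tan_phase_mem (x : Phase n) {V : Mat n × Mat n} (hV : V ∈ Tan x) :
    (x.1 : Mat n)ᴴ * V.1 ∈ iH n ∧ V.2 ∈ iH n := by
  induction hV using Submodule.span_induction with
  | mem v hv =>
    obtain ⟨c, rfl, rfl⟩ := hv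
    have h := c.hasDerivAt_phase 0
    constructor
    · rw [← mem_Tan_U]
      exact Submodule.subset_span ⟨⟨fun t => (c.toFun t).1, c.smooth.fst⟩, rfl, h.1.deriv.symm⟩
    · have h1 := hasDerivAt_conjTranspose h.2
      have h2 : (fun s => ((c.toFun s).2 : Mat n)ᴴ) = fun s => -((c.toFun s).2 : Mat n) :=
        funext fun s => mem_iH.1 (c.toFun s).2.2
      rw [h2] at h1
      exact mem_iH.2 (h1.unique h.2.neg)
  | zero => exact ⟨by simp, zero_mem _⟩
  | add v w _ _ hv hw =>
    exact ⟨by rw [Prod.fst_add, mul_add]; exact add_mem hv.1 hw.1, add_mem hv.2 hw.2⟩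
  | smul a v _ hv =>
    exact ⟨by rw [Prod.smul_fst, mul_smul_comm]; exact (iH n).smul_mem a hv.1,
      (iH n).smul_mem a hv.2⟩

/-- The exponential map `iH(n) → U(n)`. -/
noncomputable def expU (a : iH n) : U n :=
  ⟨NormedSpace.exp (a : Mat n), by
    rw [Matrix.mem_unitaryGroup_iff', Matrix.star_eq_conjTranspose, ← Matrix.exp_conjTranspose,
      mem_iH.1 a.2, ← Matrix.exp_add_of_commute _ _ (Commute.refl (a : Mat n)).neg_left]
    simp⟩

/-- A surface in `U(n) × iH(n)` with prescribed left-trivialized partial velocities at the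
origin. -/
noncomputable def expSurface (x : Phase n) (a b r s : iH n) : SmoothSurface (Phase n) where
  toFun p q := (x.1 * expU (p • a + q • b), x.2 + p • r + q • s)
  smooth := by
    change ContDiff ℝ ∞ (fun p : ℝ × ℝ =>
      ((x.1 : Mat n) * NormedSpace.exp (p.1 • (a : Mat n) + p.2 • (b : Mat n)),
        (x.2 : Mat n) + p.1 • (r : Mat n) + p.2 • (s : Mat n)))
    refine ContDiff.prodMk (contDiff_const.mul (contDiff_exp.comp ?_)) ?_
    · exact (contDiff_fst.smul contDiff_const).add (contDiff_snd.smul contDiff_const)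
    · exact (contDiff_const.add (contDiff_fst.smul contDiff_const)).add
        (contDiff_snd.smul contDiff_const)

theorem expSurface_zero (x : Phase n) (a b r s : iH n) : (expSurface x a b r s).toFun 0 0 = x := by
  refine Prod.ext (Subtype.ext ?_) (Subtype.ext ?_)
  · change (x.1 : Mat n) * NormedSpace.exp ((0 : ℝ) • (a : Mat n) + (0 : ℝ) • (b : Mat n)) = x.1
    simp
  · change (x.2 : Mat n) + (0 : ℝ) • (r : Mat n) + (0 : ℝ) • (s : Mat n) = x.2
    simp

theorem hasDerivAt_exp_smul {ι : Type*} [Fintype ι] [DecidableEq ι] (a : Matrix ι ι ℂ) :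
    HasDerivAt (fun t : ℝ => NormedSpace.exp (t • a)) a 0 := by
  have h := hasDerivAt_exp_smul_const (𝕂 := ℝ) a 0
  rwa [zero_smul, NormedSpace.exp_zero, one_mul] at h

theorem expSurface_vel₁ (x : Phase n) (a b r s : iH n) :
    ((expSurface x a b r s).vel₁ 0 0 : Mat n × Mat n) = ((x.1 : Mat n) * a, (r : Mat n)) := by
  refine HasDerivAt.deriv ?_
  change HasDerivAt (fun p : ℝ =>
      ((x.1 : Mat n) * NormedSpace.exp (p • (a : Mat n) + (0 : ℝ) • (b : Mat n)),
        (x.2 : Mat n) + p • (r : Mat n) + (0 : ℝ) • (s : Mat n))) _ 0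
  simp only [zero_smul, add_zero]
  refine ((hasDerivAt_exp_smul (a : Mat n)).const_mul (x.1 : Mat n)).prodMk ?_
  exact (((hasDerivAt_id (0 : ℝ)).smul_const (r : Mat n)).const_add (x.2 : Mat n)).congr_deriv
    (one_smul _ _)

theorem expSurface_vel₂ (x : Phase n) (a b r s : iH n) :
    ((expSurface x a b r s).vel₂ 0 0 : Mat n × Mat n) = ((x.1 : Mat n) * b, (s : Mat n)) := by
  refine HasDerivAt.deriv ?_
  change HasDerivAt (fun p : ℝ =>
      ((x.1 : Mat n) * NormedSpace.exp ((0 : ℝ) • (a : Mat n) + p • (b : Mat n)),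
        (x.2 : Mat n) + (0 : ℝ) • (r : Mat n) + p • (s : Mat n))) _ 0
  simp only [zero_smul, add_zero, zero_add]
  refine ((hasDerivAt_exp_smul (b : Mat n)).const_mul (x.1 : Mat n)).prodMk ?_
  exact (((hasDerivAt_id (0 : ℝ)).smul_const (s : Mat n)).const_add (x.2 : Mat n)).congr_deriv
    (one_smul _ _)

/-- The converse of `tan_phase_mem`: the tangent space is exactly Z·iH(n) × iH(n), which is what
makes the left-trivialized components free parameters. -/
theorem mem_Tan_phase (x : Phase n) (a r : iH n) : ((x.1 : Mat n) * a, (r : Mat n)) ∈ Tan x := by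
  have h := ((expSurface x a 0 r 0).vel₁ 0 0).2
  rwa [expSurface_vel₁, expSurface_zero] at h

/-- The left-trivialized base component of a tangent vector. -/
def leftComp (x : Phase n) (V : Tan x) : iH n :=
  ⟨(x.1 : Mat n)ᴴ * (V : Mat n × Mat n).1, (tan_phase_mem x V.2).1⟩

/-- The fibre component of a tangent vector. -/
def fibreComp (x : Phase n) (V : Tan x) : iH n :=
  ⟨(V : Mat n × Mat n).2, (tan_phase_mem x V.2).2⟩

theorem mul_leftComp (x : Phase n) (V : Tan x) :
    (x.1 : Mat n) * (leftComp x V : Mat n) = (V : Mat n × Mat n).1 := by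
  change (x.1 : Mat n) * ((x.1 : Mat n)ᴴ * (V : Mat n × Mat n).1) = _
  rw [← mul_assoc, U.mul_star, one_mul]

theorem conjTranspose_fst (x : Phase n) (V : Tan x) :
    (V : Mat n × Mat n).1ᴴ = -((leftComp x V : Mat n) * (x.1 : Mat n)ᴴ) := by
  rw [← mul_leftComp, Matrix.conjTranspose_mul, mem_iH.1 (leftComp x V).2, neg_mul]

/-- The tangent vector with given left-trivialized components. -/
def tanMk (x : Phase n) (a r : iH n) : Tan x := ⟨_, mem_Tan_phase x a r⟩

theorem leftComp_tanMk (x : Phase n) (a r : iH n) : leftComp x (tanMk x a r) = a := by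
  refine Subtype.ext ?_
  change (x.1 : Mat n)ᴴ * ((x.1 : Mat n) * a) = a
  rw [← mul_assoc, U.star_mul, one_mul]

theorem fibreComp_tanMk (x : Phase n) (a r : iH n) : fibreComp x (tanMk x a r) = r := rfl

theorem tan_ext (x : Phase n) {V W : Tan x} (h1 : leftComp x V = leftComp x W)
    (h2 : fibreComp x V = fibreComp x W) : V = W := by
  refine Subtype.ext (Prod.ext ?_ (congrArg Subtype.val h2))
  rw [← mul_leftComp, ← mul_leftComp, h1]

theorem leftComp_add (x : Phase n) (V W : Tan x) :
    leftComp x (V + W) = leftComp x V + leftComp x W := Subtype.ext (mul_add _ _ _)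

theorem leftComp_smul (x : Phase n) (r : ℝ) (V : Tan x) :
    leftComp x (r • V) = r • leftComp x V := Subtype.ext (mul_smul_comm _ _ _)

theorem fibreComp_add (x : Phase n) (V W : Tan x) :
    fibreComp x (V + W) = fibreComp x V + fibreComp x W := rfl

theorem fibreComp_smul (x : Phase n) (r : ℝ) (V : Tan x) :
    fibreComp x (r • V) = r • fibreComp x V := rfl

/-! ### The canonical one-form and its exterior derivative -/

theorem gamma0_apply (x : Phase n) (V : Tan x) : gamma0 x V =
    (Matrix.trace ((x.2 : Mat n) * (x.1 : Mat n)ᴴ * (V : Mat n × Mat n).1)).re := rfl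

theorem ofReal_gamma0 (x : Phase n) (V : Tan x) : ((gamma0 x V : ℝ) : ℂ) =
    Matrix.trace ((x.2 : Mat n) * (x.1 : Mat n)ᴴ * (V : Mat n × Mat n).1) := by
  rw [gamma0_apply, mul_assoc]
  exact ofReal_re_trace_mul x.2.2 (tan_phase_mem x V.2).1

/-- The symplectic form `dγ₀` in left-trivialized components. -/
noncomputable def omega (x : Phase n) : Tan x →ₗ[ℝ] Tan x →ₗ[ℝ] ℝ :=
  LinearMap.mk₂ ℝ (fun V W => (Matrix.trace ((fibreComp x V : Mat n) * (leftComp x W : Mat n)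
      - (fibreComp x W : Mat n) * (leftComp x V : Mat n)
      - (x.2 : Mat n) * ((leftComp x V : Mat n) * (leftComp x W : Mat n)
        - (leftComp x W : Mat n) * (leftComp x V : Mat n)))).re)
    (fun V V' W => by
      rw [← Complex.add_re, ← Matrix.trace_add, leftComp_add, fibreComp_add]
      simp only [Submodule.coe_add]
      congr 2; noncomm_ring)
    (fun r V W => by
      rw [leftComp_smul, fibreComp_smul]
      simp only [Submodule.coe_smul, smul_mul_assoc, mul_smul_comm, ← smul_sub, Matrix.trace_smul,
        Complex.smul_re])
    (fun V W W' => by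
      rw [← Complex.add_re, ← Matrix.trace_add, leftComp_add, fibreComp_add]
      simp only [Submodule.coe_add]
      congr 2; noncomm_ring)
    (fun r V W => by
      rw [leftComp_smul, fibreComp_smul]
      simp only [Submodule.coe_smul, smul_mul_assoc, mul_smul_comm, ← smul_sub, Matrix.trace_smul,
        Complex.smul_re])

theorem omega_apply (x : Phase n) (V W : Tan x) : omega x V W =
    (Matrix.trace ((fibreComp x V : Mat n) * (leftComp x W : Mat n)
      - (fibreComp x W : Mat n) * (leftComp x V : Mat n)
      - (x.2 : Mat n) * ((leftComp x V : Mat n) * (leftComp x W : Mat n)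
        - (leftComp x W : Mat n) * (leftComp x V : Mat n)))).re := rfl

theorem omega_isAlt (x : Phase n) : (omega x).IsAlt := fun V => by
  rw [omega_apply, sub_self, sub_self, mul_zero, sub_self]; simp

/-- For V = (a, r), pairing with (0, a) gives -Tr(a²), so a = 0; then pairing with (r, 0) gives
Tr(r²), so r = 0. Antisymmetry handles the other side. -/
theorem omega_nondegenerate (x : Phase n) : (omega x).Nondegenerate := by
  have hl : ∀ V, (∀ W, omega x V W = 0) → V = 0 := by
    intro V h
    have h1 : leftComp x V = 0 := by
      have := h (tanMk x 0 (leftComp x V))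
      rw [omega_apply, leftComp_tanMk, fibreComp_tanMk] at this
      refine Subtype.ext (eq_zero_of_re_trace_mul_self (leftComp x V).2 ?_)
      simpa using this
    have h2 : fibreComp x V = 0 := by
      have := h (tanMk x (fibreComp x V) 0)
      rw [omega_apply, leftComp_tanMk, fibreComp_tanMk, h1] at this
      refine Subtype.ext (eq_zero_of_re_trace_mul_self (fibreComp x V).2 ?_)
      simpa using this
    refine tan_ext x (h1.trans (Subtype.ext ?_)) (h2.trans rfl)
    exact (mul_zero _).symm
  exact ⟨hl, fun V h => hl V fun W => by rw [← (omega_isAlt x).neg, h, neg_zero]⟩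

/-- Differentiating Tr(ρZ⁺∂ₜZ) in s and Tr(ρZ⁺∂ₛZ) in t, the mixed derivatives of Z cancel in the
difference. With ∂ₛZ = Za and ∂ₜZ = Zb, the terms containing the derivative of Z⁺ contribute -ρ(ab -
ba), and the rest comes from the derivatives of ρ. -/
theorem isExteriorDerivative_omega (n : ℕ) : IsExteriorDerivative gamma0 (omega (n := n)) := by
  intro σ
  set Z : ℝ × ℝ → Mat n := fun p => ((σ.toFun p.1 p.2).1 : Mat n)
  set R : ℝ × ℝ → Mat n := fun p => ((σ.toFun p.1 p.2).2 : Mat n)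
  have hZs : ContDiff ℝ ∞ Z := σ.smooth.fst
  have hRs : ContDiff ℝ ∞ R := σ.smooth.snd
  obtain ⟨Z₁, Z₂, hZ1, hZ2, hm⟩ := exists_partials hZs
  obtain ⟨R₁, R₂, hR1, hR2, -⟩ := exists_partials hRs
  have h1 : ∀ s t, (σ.vel₁ s t : Mat n × Mat n)
      = (Z₁ s t, R₁ s t) := fun s t =>
    ((hZ1 s t).prodMk (hR1 s t)).deriv
  have h2 : ∀ s t, (σ.vel₂ s t : Mat n × Mat n)
      = (Z₂ s t, R₂ s t) := fun s t =>
    ((hZ2 s t).prodMk (hR2 s t)).deriv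
  obtain ⟨m, hm1, hm2⟩ := hm 0 0
  have e1 : (fun s => gamma0 (σ.toFun s 0) (σ.vel₂ s 0))
      = fun s => (Matrix.trace (R (s, 0) * (Z (s, 0))ᴴ * Z₂ s 0)).re :=
    funext fun s => by rw [gamma0_apply, h2]
  have e2 : (fun t => gamma0 (σ.toFun 0 t) (σ.vel₁ 0 t))
      = fun t => (Matrix.trace (R (0, t) * (Z (0, t))ᴴ * Z₁ 0 t)).re :=
    funext fun s => by rw [gamma0_apply, h1]
  rw [e1, e2]
  refine ⟨_, _, hasDerivAt_re_trace (((hR1 0 0).mul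
    (hasDerivAt_conjTranspose (hZ1 0 0))).mul hm1),
    hasDerivAt_re_trace (((hR2 0 0).mul
    (hasDerivAt_conjTranspose (hZ2 0 0))).mul hm2), ?_⟩
  have k1 : (σ.vel₁ 0 0 : Mat n × Mat n).1 = Z₁ 0 0 := by rw [h1]
  have k2 : (σ.vel₂ 0 0 : Mat n × Mat n).1 = Z₂ 0 0 := by rw [h2]
  have k3 : (fibreComp _ (σ.vel₁ 0 0) : Mat n) = R₁ 0 0 :=
    congrArg Prod.snd (h1 0 0)
  have k4 : (fibreComp _ (σ.vel₂ 0 0) : Mat n) = R₂ 0 0 :=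
    congrArg Prod.snd (h2 0 0)
  have c1 : (Z₁ 0 0)ᴴ = -((leftComp _ (σ.vel₁ 0 0) : Mat n) * (Z (0, 0))ᴴ) := by
    rw [← k1]; exact conjTranspose_fst _ _
  have c2 : (Z₂ 0 0)ᴴ = -((leftComp _ (σ.vel₂ 0 0) : Mat n) * (Z (0, 0))ᴴ) := by
    rw [← k2]; exact conjTranspose_fst _ _
  have l1 : (leftComp _ (σ.vel₁ 0 0) : Mat n) = (Z (0, 0))ᴴ * Z₁ 0 0 := by
    rw [← k1]; rfl
  have l2 : (leftComp _ (σ.vel₂ 0 0) : Mat n) = (Z (0, 0))ᴴ * Z₂ 0 0 := by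
    rw [← k2]; rfl
  rw [omega_apply, ← Complex.sub_re, ← Matrix.trace_sub, k3, k4, c1, c2, l1, l2]
  change (Matrix.trace (_ - R (0, 0) * _)).re = (Matrix.trace (_ + R (0, 0) * (Z (0, 0))ᴴ * m
    - (_ + R (0, 0) * (Z (0, 0))ᴴ * m))).re
  congr 2
  noncomm_ring

/-- The defining condition sees Ω only on partial velocities of surfaces. Every pair of tangent
vectors at x arises in this way from an exponential surface, so the condition determines Ω. -/
theorem IsExteriorDerivative.eq_omega
    {Ω : ∀ x : Phase n, Tan x →ₗ[ℝ] Tan x →ₗ[ℝ] ℝ} (hΩ : IsExteriorDerivative gamma0 Ω) :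
    Ω = omega := by
  funext x
  refine LinearMap.ext fun V => LinearMap.ext fun W => ?_
  obtain ⟨σ, rfl, hV, hW⟩ : ∃ σ : SmoothSurface (Phase n), σ.toFun 0 0 = x ∧
      (σ.vel₁ 0 0 : Mat n × Mat n) = V ∧ (σ.vel₂ 0 0 : Mat n × Mat n) = W :=
    ⟨expSurface x (leftComp x V) (leftComp x W) (fibreComp x V) (fibreComp x W),
      expSurface_zero .., by rw [expSurface_vel₁, mul_leftComp]; rfl,
      by rw [expSurface_vel₂, mul_leftComp]; rfl⟩
  obtain rfl : σ.vel₁ 0 0 = V := Subtype.ext hV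
  obtain rfl : σ.vel₂ 0 0 = W := Subtype.ext hW
  obtain ⟨a, b, ha, hb, h⟩ := hΩ σ
  obtain ⟨a', b', ha', hb', h'⟩ := isExteriorDerivative_omega n σ
  rw [h, h', ha.unique ha', hb.unique hb']

/-- The trivialization covers the identity of U(n), so dπ of the image velocity is just the velocity
of Z, on which the covector is the pairing with ρ. -/
theorem canonicalForm_leftTriv (c : SmoothCurve (Phase n)) :
    ∃ c' : SmoothCurve (CotU n), (∀ t, c'.toFun t = leftTriv n (c.toFun t)) ∧
      canonicalForm (c'.toFun 0) (c'.vel 0) = gamma0 (c.toFun 0) (c.vel 0) := by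
  obtain ⟨_, _, _, hs, _⟩ := isDiffeo_leftTriv n
  refine ⟨c.map hs, fun _ => rfl, ?_⟩
  have h1 : ((c.map hs).vel 0 : Mat n × Mat n).1 = (c.vel 0 : Mat n × Mat n).1 :=
    (hasDerivAt_fst ((c.map hs).hasDerivAt 0)).unique (c.hasDerivAt_phase 0).1
  change leftPairing (c.toFun 0).1 (c.toFun 0).2 ((c.map hs).vel 0 : Mat n × Mat n).1 = _
  rw [h1]
  rfl

theorem hasDerivAt_numer (g : Unn n) (c : SmoothCurve (Phase n)) (t : ℝ) :
    HasDerivAt (fun s => numer g (c.toFun s).1)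
      (g.mat.toBlocks₁₁ * (c.vel t : Mat n × Mat n).1) t :=
  ((c.hasDerivAt_phase t).1.const_mul _).add_const _

theorem hasDerivAt_denom (g : Unn n) (c : SmoothCurve (Phase n)) (t : ℝ) :
    HasDerivAt (fun s => denom g (c.toFun s).1)
      (g.mat.toBlocks₂₁ * (c.vel t : Mat n × Mat n).1) t :=
  ((c.hasDerivAt_phase t).1.const_mul _).add_const _

/-- Put N = AZ+B, M = CZ+D and Z' = NM⁻¹. Then dZ' = (A - Z'C) dZ M⁻¹ and MρM⁺Z'⁺ = MρN⁺, so by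
cyclicity the transformed form is Tr(ρN⁺(A - Z'C) dZ). Finally N⁺Z' = M⁺ and N⁺A - M⁺C = Z⁺. -/
theorem gamma0_invariant (g : Unn n) (c : SmoothCurve (Phase n)) :
    ∃ c' : SmoothCurve (Phase n), (∀ t, c'.toFun t = Lam g (c.toFun t)) ∧
      gamma0 (c'.toFun 0) (c'.vel 0) = gamma0 (c.toFun 0) (c.vel 0) := by
  refine ⟨c.map (isSmooth_Lam g), fun _ => rfl, ?_⟩
  set x := c.toFun 0
  set v := (c.vel 0 : Mat n × Mat n).1 with hv
  have h1 : ((c.map (isSmooth_Lam g)).vel 0 : Mat n × Mat n).1 = _ :=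
    ((c.map (isSmooth_Lam g)).hasDerivAt_phase 0).1.unique
      (hasDerivAt_mul_inv (hasDerivAt_numer g c 0) (hasDerivAt_denom g c 0)
        fun s => denom_isUnit g (c.toFun s).1)
  rw [gamma0_apply, gamma0_apply, h1, ← hv]
  change (Matrix.trace (denom g x.1 * (x.2 : Mat n) * (denom g x.1)ᴴ
    * (numer g x.1 * (denom g x.1)⁻¹)ᴴ
    * (g.mat.toBlocks₁₁ * v * (denom g x.1)⁻¹
      - numer g x.1 * (denom g x.1)⁻¹ * (g.mat.toBlocks₂₁ * v) * (denom g x.1)⁻¹))).re = _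
  have hu := (Matrix.isUnit_iff_isUnit_det _).1 (denom_isUnit g x.1)
  have hns := numer_star_mul g x.1
  have hD : (denom g x.1)ᴴ * (numer g x.1 * (denom g x.1)⁻¹)ᴴ = (numer g x.1)ᴴ := by
    rw [← Matrix.conjTranspose_mul, mul_assoc, Matrix.nonsing_inv_mul _ hu, mul_one]
  -- The relations A⁺A = 1 + C⁺C and B⁺A = D⁺C turn N⁺A into Z⁺ + (CZ+D)⁺C.
  have key : (numer g x.1)ᴴ * g.mat.toBlocks₁₁ - (denom g x.1)ᴴ * g.mat.toBlocks₂₁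
      = (x.1 : Mat n)ᴴ := by
    obtain ⟨b1, -, b3, -⟩ := block_identities g
    rw [numer, denom, Matrix.conjTranspose_add, Matrix.conjTranspose_add, Matrix.conjTranspose_mul,
      Matrix.conjTranspose_mul, add_mul, add_mul, mul_assoc, mul_assoc, b1, b3, mul_add, mul_one]
    abel
  have hN : (numer g x.1)ᴴ * (numer g x.1 * (denom g x.1)⁻¹) = (denom g x.1)ᴴ := by
    rw [← mul_assoc, hns, mul_assoc, Matrix.mul_nonsing_inv _ hu, mul_one]
  set D := denom g x.1
  set N := numer g x.1
  have e : D * (x.2 : Mat n) * Dᴴ * (N * D⁻¹)ᴴ * (g.mat.toBlocks₁₁ * v * D⁻¹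
      - N * D⁻¹ * (g.mat.toBlocks₂₁ * v) * D⁻¹)
      = D * ((x.2 : Mat n) * (x.1 : Mat n)ᴴ * v * D⁻¹) := by
    calc _ = D * (x.2 : Mat n) * (Dᴴ * (N * D⁻¹)ᴴ) * (g.mat.toBlocks₁₁ * v
          - N * D⁻¹ * (g.mat.toBlocks₂₁ * v)) * D⁻¹ := by simp only [mul_sub, sub_mul, mul_assoc]
      _ = D * (x.2 : Mat n) * (Nᴴ * g.mat.toBlocks₁₁ * v
          - Nᴴ * (N * D⁻¹) * g.mat.toBlocks₂₁ * v) * D⁻¹ := by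
        rw [hD]; simp only [mul_sub, sub_mul, mul_assoc]
      _ = _ := by
        rw [hN, ← sub_mul, key]; simp only [mul_assoc]
  rw [e, Matrix.trace_mul_comm, mul_assoc _ D⁻¹, Matrix.nonsing_inv_mul _ hu, mul_one]

/-! ### The momentum map -/

/-- The left-trivialized base velocity of the infinitesimal action of the element of `u(n,n)` with
blocks `a`, `b`, `b⁺`, `d`. -/
noncomputable def actLeft (a d : iH n) (b : Mat n) (x : Phase n) : Mat n :=
  (x.1 : Mat n)ᴴ * (a : Mat n) * (x.1 : Mat n) + (x.1 : Mat n)ᴴ * b - bᴴ * (x.1 : Mat n)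
    - (d : Mat n)

/-- The fibre velocity of the infinitesimal action. -/
noncomputable def actFibre (d : iH n) (b : Mat n) (x : Phase n) : Mat n :=
  (bᴴ * (x.1 : Mat n) + (d : Mat n)) * (x.2 : Mat n)
    + (x.2 : Mat n) * ((x.1 : Mat n)ᴴ * b - (d : Mat n))

/-- At t = 0 the numerator is Z with derivative aZ + b, and the denominator is 1 with derivative b⁺Z
+ d. The quotient and product rules then give dZ = aZ + b - Z(b⁺Z + d) and dρ = (b⁺Z + d)ρ + ρ(b⁺Z +
d)⁺. -/
theorem exists_curve_Lam_exp (a d : iH n) (b : Mat n) (x : Phase n) :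
    ∃ (c : SmoothCurve (Phase n)) (V : Tan x),
      (∀ t : ℝ, c.toFun t = Lam (expUnn (t • ofBlocks a b d)) x) ∧
      (V : Mat n × Mat n) = c.vel 0 ∧ (leftComp x V : Mat n) = actLeft a d b x ∧
      (fibreComp x V : Mat n) = actFibre d b x := by
  set ξ := ofBlocks a b d
  set e : ℝ → Mat2 n := fun t => NormedSpace.exp (t • (ξ : Mat2 n))
  set N : ℝ → Mat n := fun t => numer (expUnn (t • ξ)) x.1
  set D : ℝ → Mat n := fun t => denom (expUnn (t • ξ)) x.1
  have hes : ContDiff ℝ ∞ e := contDiff_exp.comp (contDiff_id.smul contDiff_const)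
  have hu : ∀ t, IsUnit (D t) := fun t => denom_isUnit _ x.1
  obtain ⟨s1, s2, s3, s4⟩ := contDiff_toBlocks hes
  have hNs : ContDiff ℝ ∞ N := (s1.mul contDiff_const).add s2
  have hDs : ContDiff ℝ ∞ D := (s3.mul contDiff_const).add s4
  let c : SmoothCurve (Phase n) :=
    { toFun := fun t => Lam (expUnn (t • ξ)) x
      smooth := by
        change ContDiff ℝ ∞ fun t => (N t * (D t)⁻¹, D t * (x.2 : Mat n) * (D t)ᴴ)
        refine ContDiff.prodMk (hNs.mul (contDiff_iff_contDiffAt.2 fun t => ?_))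
          ((hDs.mul contDiff_const).mul (contDiff_conjTranspose hDs))
        exact (contDiffAt_inv (hu t)).comp t hDs.contDiffAt }
  have h0 : expUnn ((0 : ℝ) • ξ) = 1 := by
    refine Subtype.ext (Units.ext ?_)
    change NormedSpace.exp ((0 : ℝ) • (ξ : Mat2 n)) = 1
    rw [zero_smul, NormedSpace.exp_zero]
  have hc0 : c.toFun 0 = x := by
    change Lam (expUnn ((0 : ℝ) • ξ)) x = x
    rw [h0, Lam_one]
  have hN0 : numer (expUnn ((0 : ℝ) • ξ)) x.1 = x.1 := by
    simp only [h0, numer, Unn.mat_one]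
    simp [← Matrix.fromBlocks_one]
  have hD0 : denom (expUnn ((0 : ℝ) • ξ)) x.1 = 1 := by
    simp only [h0, denom, Unn.mat_one]
    simp [← Matrix.fromBlocks_one]
  obtain ⟨d1, d2, d3, d4⟩ := hasDerivAt_toBlocks (hasDerivAt_exp_smul (ξ : Mat2 n))
  have hN' : HasDerivAt N ((a : Mat n) * (x.1 : Mat n) + b) 0 := (d1.mul_const _).add d2
  have hD' : HasDerivAt D (bᴴ * (x.1 : Mat n) + (d : Mat n)) 0 := (d3.mul_const _).add d4
  have hv1 : (c.vel 0 : Mat n × Mat n).1 = _ :=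
    (c.hasDerivAt_phase 0).1.unique (hasDerivAt_mul_inv hN' hD' hu)
  have hv2 : (c.vel 0 : Mat n × Mat n).2 = _ := (c.hasDerivAt_phase 0).2.unique
    ((hD'.mul_const (x.2 : Mat n)).mul (hasDerivAt_conjTranspose hD'))
  have hD0' : D 0 = 1 := hD0
  simp only [hN0, hD0, hD0', inv_one, mul_one, Matrix.conjTranspose_one, one_mul] at hv1 hv2
  -- The curve starts at `x` only propositionally, so the velocity is transported to `Tan x` and
  -- compared with `c.vel 0` in the ambient space.
  refine ⟨c, ⟨c.vel 0, hc0 ▸ (c.vel 0).2⟩, fun _ => rfl, rfl, ?_, ?_⟩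
  · change (x.1 : Mat n)ᴴ * (c.vel 0 : Mat n × Mat n).1 = _
    rw [hv1, actLeft, mul_sub, mul_add, ← mul_assoc, ← mul_assoc (x.1 : Mat n)ᴴ (x.1 : Mat n),
      U.star_mul, one_mul]
    abel
  · change (c.vel 0 : Mat n × Mat n).2 = _
    rw [hv2, actFibre, Matrix.conjTranspose_add, Matrix.conjTranspose_mul,
      Matrix.conjTranspose_conjTranspose, mem_iH.1 d.2, ← sub_eq_add_neg]

theorem coe_ofBlocks (a d : iH n) (b : Mat n) :
    (ofBlocks a b d : Mat2 n) = Matrix.fromBlocks (a : Mat n) b bᴴ (d : Mat n) := rfl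

theorem trace_fromBlocks (a b c d : Mat n) :
    Matrix.trace (Matrix.fromBlocks a b c d) = Matrix.trace a + Matrix.trace d := by
  simp [Matrix.trace]

theorem trace_fromBlocks_mul (a b c d a' b' c' d' : Mat n) :
    Matrix.trace (Matrix.fromBlocks a b c d * Matrix.fromBlocks a' b' c' d')
      = Matrix.trace (a * a') + Matrix.trace (b * c') + Matrix.trace (c * b')
        + Matrix.trace (d * d') := by
  rw [Matrix.fromBlocks_multiply, trace_fromBlocks, Matrix.trace_add, Matrix.trace_add]
  ring

/-- The core of the momentum map property, with Z conjugated away: `a`, `κ`, `κ'` stand for Z⁺aZ,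
b⁺Z, Z⁺b, and (`τ`, `r`) are the components of the test vector. The left side is dγ₀ on the
generator and the test vector, the right side the derivative of Tr(J₀ξ). Only cyclicity is needed,
so the matrices are arbitrary. -/
theorem momentum_trace_identity (a κ κ' d ρ τ r : Mat n) :
    Matrix.trace (((κ + d) * ρ + ρ * (κ' - d)) * τ - r * (a + κ' - κ - d)
        - ρ * ((a + κ' - κ - d) * τ - τ * (a + κ' - κ - d)))
      = -Matrix.trace ((τ * ρ + r - ρ * τ) * a) + Matrix.trace ((τ * ρ + r) * κ)
        + Matrix.trace ((ρ * τ - r) * κ') + Matrix.trace (r * d) := by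
  have h1 := Matrix.trace_mul_comm κ (ρ * τ)
  have h2 := Matrix.trace_mul_comm d (ρ * τ)
  have h3 := Matrix.trace_mul_comm τ (ρ * a)
  have h4 := Matrix.trace_mul_comm τ (ρ * κ)
  simp only [mul_add, add_mul, mul_sub, sub_mul, Matrix.trace_add, Matrix.trace_sub, ← mul_assoc]
    at h1 h2 h3 h4 ⊢
  linear_combination h1 + h2 + h3 - h4

theorem hasDerivAt_J0Mat {p : ℝ → Mat n × Mat n} {p' : Mat n × Mat n} {t : ℝ}
    (hp : HasDerivAt p p' t) : HasDerivAt (fun s => J0Mat (p s)) (Matrix.fromBlocks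
      (-((p'.1 * (p t).2 + (p t).1 * p'.2) * (p t).1ᴴ + (p t).1 * (p t).2 * p'.1ᴴ))
      (p'.1 * (p t).2 + (p t).1 * p'.2) (p'.1 * (p t).2 + (p t).1 * p'.2)ᴴ p'.2) t := by
  have h1 := hasDerivAt_fst hp
  have h2 := hasDerivAt_snd hp
  have h3 := h1.mul h2
  exact (fromBlocksL n).hasFDerivAt.comp_hasDerivAt t
    (((h3.mul (hasDerivAt_conjTranspose h1)).neg.prodMk h3).prodMk
      ((hasDerivAt_conjTranspose h3).prodMk h2))

theorem traceForm_apply (X Y : unn n) :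
    traceForm n X Y = (Matrix.trace ((X : Mat2 n) * (Y : Mat2 n))).re := rfl

/-- The infinitesimal generator of `ξ` is the Hamiltonian vector of `Tr(J₀ ξ)`. -/
theorem isHamiltonianVector_momentum (a d : iH n) (b : Mat n) (x : Phase n) (V : Tan x)
    (h1 : (leftComp x V : Mat n) = actLeft a d b x)
    (h2 : (fibreComp x V : Mat n) = actFibre d b x) :
    IsHamiltonianVector omega (fun y => traceForm n (J0 y) (ofBlocks a b d)) x V := by
  intro c W hc hW
  have hd : HasDerivAt (fun t => emb (c.toFun t)) (W : Mat n × Mat n) 0 := by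
    rw [hW]; exact c.hasDerivAt 0
  refine (hasDerivAt_re_trace ((hasDerivAt_J0Mat hd).mul_const
    (ofBlocks a b d : Mat2 n))).congr_deriv ?_
  rw [hc, omega_apply, h1, h2, actLeft, actFibre, coe_ofBlocks, trace_fromBlocks_mul,
    momentum_trace_identity]
  change (Matrix.trace (-(((W : Mat n × Mat n).1 * (x.2 : Mat n) + (x.1 : Mat n)
      * (fibreComp x W : Mat n)) * (x.1 : Mat n)ᴴ
      + (x.1 : Mat n) * (x.2 : Mat n) * (W : Mat n × Mat n).1ᴴ) * (a : Mat n))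
    + Matrix.trace (((W : Mat n × Mat n).1 * (x.2 : Mat n) + (x.1 : Mat n)
      * (fibreComp x W : Mat n)) * bᴴ)
    + Matrix.trace (((W : Mat n × Mat n).1 * (x.2 : Mat n) + (x.1 : Mat n)
      * (fibreComp x W : Mat n))ᴴ * b)
    + Matrix.trace ((fibreComp x W : Mat n) * (d : Mat n))).re = _
  rw [conjTranspose_fst, ← mul_leftComp]
  have hr := mem_iH.1 (fibreComp x W).2
  have hτ := mem_iH.1 (leftComp x W).2
  have hρ := mem_iH.1 x.2.2
  generalize (fibreComp x W : Mat n) = r at *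
  generalize (leftComp x W : Mat n) = τ at *
  generalize (x.2 : Mat n) = ρ at *
  generalize (x.1 : Mat n) = Z at *
  -- The contributions of the blocks a, b⁺ and b are matched one by one: Z is moved around the
  -- trace, and for b the adjoint is expanded using that r, τ and ρ are anti-Hermitian.
  congr 2
  · congr 1
    · congr 1
      · rw [neg_mul, Matrix.trace_neg, ← mul_assoc (_ - _), Matrix.trace_mul_comm _ Z]
        congr 2
        noncomm_ring
      · rw [← mul_assoc, Matrix.trace_mul_comm _ Z]
        congr 1
        noncomm_ring
    · rw [← mul_assoc]
      congr 2
      rw [mul_assoc, ← mul_add, Matrix.conjTranspose_mul, Matrix.conjTranspose_add,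
        Matrix.conjTranspose_mul, hr, hτ, hρ]
      noncomm_ring

/-! ### The Poisson map -/

theorem traceForm_grad (f : unn n → ℝ) (X Y : unn n) :
    traceForm n (grad f X) Y = fderiv ℝ f X Y :=
  LinearMap.BilinForm.apply_toDual_symm_apply (hB := traceForm_nondegenerate n) _ _

theorem traceForm_comm (X Y : unn n) : traceForm n X Y = traceForm n Y X := by
  rw [traceForm_apply, traceForm_apply, Matrix.trace_mul_comm]

/-- A linear left inverse of the inclusion, continuous in finite dimension, carries the ambient
derivative into the subspace. This bridges J₀, differentiated as a matrix, and functions `f` defined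
on u(n,n) only. -/
theorem exists_hasDerivAt_subtype {E : Type*} [NormedAddCommGroup E] [NormedSpace ℝ E]
    [FiniteDimensional ℝ E] {p : Submodule ℝ E} {k : ℝ → p} {K : E} {t : ℝ}
    (h : HasDerivAt (fun s => (k s : E)) K t) : ∃ k' : p, (k' : E) = K ∧ HasDerivAt k k' t := by
  obtain ⟨q, hq⟩ := p.subtype.exists_leftInverse_of_injective p.ker_subtype
  have h1 : HasDerivAt k (q K) t := by
    have := (LinearMap.toContinuousLinearMap q).hasFDerivAt.comp_hasDerivAt t h
    refine this.congr_of_eventuallyEq (.of_forall fun s => ?_)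
    exact (LinearMap.congr_fun hq (k s)).symm
  exact ⟨q K, (p.subtypeL.hasFDerivAt.comp_hasDerivAt t h1).unique h, h1⟩

/-- The Hamiltonian vector of `f ∘ J₀` at `x` is that of `Tr(J₀ ξ)`, where `ξ = df(J₀(x))`. -/
theorem isHamiltonianVector_comp_J0 {f : unn n → ℝ} (hf : ContDiff ℝ ∞ f) {x : Phase n} {V : Tan x}
    (hV : IsHamiltonianVector omega (fun y => traceForm n (J0 y) (grad f (J0 x))) x V) :
    IsHamiltonianVector omega (f ∘ J0) x V := by
  intro c W hc hW
  obtain ⟨K, hK⟩ : ∃ K, HasDerivAt (fun t => (J0 (c.toFun t) : Mat2 n)) K 0 :=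
    ⟨_, (((isSmooth_J0 n).contDiff_curve c).differentiable (by simp) 0).hasDerivAt⟩
  obtain ⟨k, rfl, hk⟩ := exists_hasDerivAt_subtype hK
  have h1 : omega x V W = traceForm n k (grad f (J0 x)) :=
    (hV c W hc hW).unique (hasDerivAt_re_trace (hK.mul_const (grad f (J0 x) : Mat2 n)))
  -- Pairing the velocity of J₀ with the gradient at J₀(x) is by definition the differential of `f`
  -- on that velocity, so the claim becomes the chain rule.
  rw [h1, traceForm_comm, traceForm_grad, ← hc]
  exact (hf.differentiable (by simp) _).hasFDerivAt.comp_hasDerivAt 0 hk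

/-- Let ξ, η be the gradients at J₀(x) and V, W their generators. As V is Hamiltonian for Tr(J₀ξ),
Ω(V, W) is the derivative of that function along the orbit of exp(tη). Equivariance rewrites it as
Tr(e^{tη}J₀e^{-tη}ξ), with derivative Tr([η, J₀]ξ) = Tr(J₀[ξ, η]). -/
theorem isPoissonBracket_liePoisson {f h : unn n → ℝ} (hf : ContDiff ℝ ∞ f) (hh : ContDiff ℝ ∞ h)
    (x : Phase n) :
    IsPoissonBracket omega (f ∘ J0) (h ∘ J0) x (liePoisson f h (J0 x)) := by
  obtain ⟨a, b, d, hξ⟩ := exists_ofBlocks_eq (grad f (J0 x)).2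
  obtain ⟨a', b', d', hη⟩ := exists_ofBlocks_eq (grad h (J0 x)).2
  replace hξ := Subtype.ext hξ
  replace hη := Subtype.ext hη
  obtain ⟨-, V, -, -, hV1, hV2⟩ := exists_curve_Lam_exp a d b x
  obtain ⟨c, W, hc, hcW, hW1, hW2⟩ := exists_curve_Lam_exp a' d' b' x
  have hV := isHamiltonianVector_momentum a d b x V hV1 hV2
  have hW := isHamiltonianVector_momentum a' d' b' x W hW1 hW2
  rw [hξ] at hV
  rw [hη] at hW hc
  refine ⟨V, W, isHamiltonianVector_comp_J0 hf hV, isHamiltonianVector_comp_J0 hh hW, ?_⟩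
  set ξ := grad f (J0 x)
  set η := grad h (J0 x)
  have hc0 : c.toFun 0 = x := by
    have h0 : expUnn ((0 : ℝ) • η) = 1 := by
      refine Subtype.ext (Units.ext ?_)
      change NormedSpace.exp ((0 : ℝ) • (η : Mat2 n)) = 1
      rw [zero_smul, NormedSpace.exp_zero]
    rw [hc, h0, Lam_one]
  have h1 : HasDerivAt (fun t => traceForm n (J0 (c.toFun t)) ξ) (omega x V W) 0 :=
    hV c W hc0 hcW
  have h2 : (fun t => traceForm n (J0 (c.toFun t)) ξ) = fun t =>
      (Matrix.trace (NormedSpace.exp (t • (η : Mat2 n)) * (J0 x : Mat2 n)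
        * NormedSpace.exp (t • -(η : Mat2 n)) * (ξ : Mat2 n))).re := by
    funext t
    rw [hc, traceForm_apply, ← J0_equivariant, smul_neg]
    rfl
  rw [h2] at h1
  have h3 := h1.unique (hasDerivAt_re_trace ((((hasDerivAt_exp_smul (η : Mat2 n)).mul_const _).mul
    (hasDerivAt_exp_smul (-(η : Mat2 n)))).mul_const _))
  rw [h3, liePoisson]
  simp only [zero_smul, NormedSpace.exp_zero, mul_one, one_mul]
  change (Matrix.trace (((η : Mat2 n) * (J0 x : Mat2 n) + (J0 x : Mat2 n) * -(η : Mat2 n))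
    * (ξ : Mat2 n))).re = (Matrix.trace ((J0 x : Mat2 n) * ((ξ : Mat2 n) * (η : Mat2 n)
      - (η : Mat2 n) * (ξ : Mat2 n)))).re
  congr 1
  have h4 := Matrix.trace_mul_comm (η : Mat2 n) ((J0 x : Mat2 n) * (ξ : Mat2 n))
  simp only [add_mul, mul_sub, mul_neg, neg_mul, Matrix.trace_add, Matrix.trace_sub,
    Matrix.trace_neg, mul_assoc] at h4 ⊢
  linear_combination h4

/-! ### The Lie-Poisson bracket in block coordinates -/

theorem exists_isPartials (f : unn n → ℝ) (X : unn n) :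
    ∃ fα fβ fβ' fδ : Mat n, IsPartials f X fα fβ fβ' fδ := by
  obtain ⟨α, β, δ, h⟩ := exists_ofBlocks_eq (grad f X).2
  refine ⟨α, β, βᴴ, δ, α.2, δ.2, rfl, fun a b d => ?_⟩
  rw [← traceForm_grad, traceForm_comm, traceForm_apply,
    ofReal_re_trace_mul_unn (ofBlocks a b d).2 (grad f X).2, ← h, coe_ofBlocks, coe_ofBlocks,
    trace_fromBlocks_mul, Matrix.trace_add, Matrix.trace_add, Matrix.trace_add]

/-- Nondegeneracy of the trace form makes the partial derivatives unique. In Tr(XY) the block β of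
one factor meets the lower left block of the other; since dβ is paired with ∂f/∂β⁺, this derivative
sits in the lower left of the gradient. -/
theorem IsPartials.coe_grad {f : unn n → ℝ} {X : unn n} {fα fβ fβ' fδ : Mat n}
    (h : IsPartials f X fα fβ fβ' fδ) :
    (grad f X : Mat2 n) = Matrix.fromBlocks fα fβ fβ' fδ := by
  obtain ⟨hα, hδ, rfl, hd⟩ := h
  suffices e : grad f X = ofBlocks ⟨fα, hα⟩ fβ ⟨fδ, hδ⟩ by rw [e]; rfl
  rw [grad, LinearEquiv.symm_apply_eq]
  refine LinearMap.ext fun Y => ?_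
  obtain ⟨a, b, d, hY⟩ := exists_ofBlocks_eq Y.2
  obtain rfl := Subtype.ext hY
  change fderiv ℝ f X (ofBlocks a b d)
    = traceForm n (ofBlocks ⟨fα, hα⟩ fβ ⟨fδ, hδ⟩) (ofBlocks a b d)
  rw [traceForm_comm, traceForm_apply, ← Complex.ofReal_re (fderiv ℝ f X (ofBlocks a b d)), hd,
    coe_ofBlocks, coe_ofBlocks, trace_fromBlocks_mul, Matrix.trace_add, Matrix.trace_add,
    Matrix.trace_add]

/-- The commutator of the gradients stays in u(n,n), so its trace against X is real; the formula is
then block multiplication. -/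
theorem ofReal_liePoisson (f h : unn n → ℝ) (α δ : iH n) (β : Mat n)
    {fα fβ fβ' fδ hα hβ hβ' hδ : Mat n} (hf : IsPartials f (ofBlocks α β δ) fα fβ fβ' fδ)
    (hh : IsPartials h (ofBlocks α β δ) hα hβ hβ' hδ) :
    ((liePoisson f h (ofBlocks α β δ) : ℝ) : ℂ) = Matrix.trace (
      (α : Mat n) * ((fα * hα - hα * fα) + fβ * hβ' - hβ * fβ') +
      β * (fβ' * hα + fδ * hβ' - hβ' * fα - hδ * fβ') +
      βᴴ * (fα * hβ + fβ * hδ - hα * fβ - hβ * fδ) +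
      (δ : Mat n) * ((fδ * hδ - hδ * fδ) + fβ' * hβ - hβ' * fβ)) := by
  rw [liePoisson, ofReal_re_trace_mul_unn (ofBlocks α β δ).2
    (commutator_mem_unn (grad f _).2 (grad h _).2), hf.coe_grad, hh.coe_grad, coe_ofBlocks,
    Matrix.fromBlocks_multiply, Matrix.fromBlocks_multiply, sub_eq_add_neg, Matrix.fromBlocks_neg,
    Matrix.fromBlocks_add, trace_fromBlocks_mul]
  simp only [mul_add, mul_sub, mul_neg, neg_add, Matrix.trace_add, Matrix.trace_sub,
    Matrix.trace_neg]
  ring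

end CotUn

/-! ### The theorem, assembled from the parts above -/

theorem proposition3p2 (n : ℕ) :
    -- the identification `U(n) × iH(n) ≅ T*U(n)`, `(Z, ρ) ↦ Tr(ρ Z⁺ ·)`
    (CotUn.IsDiffeo (CotUn.leftTriv n) ∧
      ∀ Z : CotUn.U n, ∃ L : CotUn.iH n ≃ₗ[ℝ] Module.Dual ℝ (CotUn.Tan Z),
        ∀ ρ : CotUn.iH n, CotUn.leftTriv n (Z, ρ) = ⟨Z, L ρ⟩ ∧
          ∀ v : CotUn.Tan Z, ((L ρ v : ℝ) : ℂ) =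
            Matrix.trace ((ρ : CotUn.Mat n) * (Z : CotUn.Mat n)ᴴ * (v : CotUn.Mat n))) ∧
    -- (i) `I₀` is an isomorphism of vector bundles
    (CotUn.IsDiffeo (CotUn.I0base (n := n)) ∧
      CotUn.IsDiffeo (CotUn.I0 (n := n)) ∧
      (∀ x : CotUn.Phase n, (CotUn.I0 x).proj = CotUn.I0base x.1) ∧
      ∀ Z : CotUn.U n, ∃ L : CotUn.iH n ≃ₗ[ℝ] CotUn.N0.fibre (CotUn.I0base Z),
        ∀ ρ : CotUn.iH n, (L ρ : CotUn.Mat2 n) = (CotUn.I0 (Z, ρ)).pr₁) ∧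
    -- (i) `Λ` and `Σ` are actions of `U(n,n)`, and `I₀` is equivariant
    ((∀ x : CotUn.Phase n, CotUn.Lam 1 x = x) ∧
      (∀ (g h : CotUn.Unn n) (x : CotUn.Phase n),
        CotUn.Lam (g * h) x = CotUn.Lam g (CotUn.Lam h x)) ∧
      (∀ g : CotUn.Unn n, CotUn.IsSmooth (CotUn.Lam g)) ∧
      (∀ p : CotUn.N0 n, CotUn.Sig 1 p = p) ∧
      (∀ (g h : CotUn.Unn n) (p : CotUn.N0 n),
        CotUn.Sig (g * h) p = CotUn.Sig g (CotUn.Sig h p)) ∧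
      (∀ g : CotUn.Unn n, CotUn.IsSmooth (CotUn.Sig g)) ∧
      ∀ (g : CotUn.Unn n) (x : CotUn.Phase n),
        CotUn.I0 (CotUn.Lam g x) = CotUn.Sig g (CotUn.I0 x)) ∧
    -- (ii) the canonical one-form in the coordinates `(Z, ρ)`, and its invariance under `Λ`
    ((∀ (x : CotUn.Phase n) (V : CotUn.Tan x), ((CotUn.gamma0 x V : ℝ) : ℂ) =
        Matrix.trace ((x.2 : CotUn.Mat n) * (x.1 : CotUn.Mat n)ᴴ *
          (V : CotUn.Mat n × CotUn.Mat n).1)) ∧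
      (∀ c : CotUn.SmoothCurve (CotUn.Phase n), ∃ c' : CotUn.SmoothCurve (CotUn.CotU n),
        (∀ t, c'.toFun t = CotUn.leftTriv n (c.toFun t)) ∧
        CotUn.canonicalForm (c'.toFun 0) (c'.vel 0) = CotUn.gamma0 (c.toFun 0) (c.vel 0)) ∧
      ∀ (g : CotUn.Unn n) (c : CotUn.SmoothCurve (CotUn.Phase n)),
        ∃ c' : CotUn.SmoothCurve (CotUn.Phase n),
          (∀ t, c'.toFun t = CotUn.Lam g (c.toFun t)) ∧
          CotUn.gamma0 (c'.toFun 0) (c'.vel 0) = CotUn.gamma0 (c.toFun 0) (c.vel 0)) ∧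
    -- (iii) `J₀ = pr₁ ∘ I₀` is smooth and equivariant
    ((∀ x : CotUn.Phase n, (CotUn.J0 x : CotUn.Mat2 n) = (CotUn.I0 x).pr₁) ∧
      CotUn.IsSmooth (CotUn.J0 (n := n)) ∧
      ∀ (g : CotUn.Unn n) (x : CotUn.Phase n),
        g.mat * (CotUn.J0 x : CotUn.Mat2 n) * (g⁻¹).mat = CotUn.J0 (CotUn.Lam g x)) ∧
    -- (iii) `dγ₀` is symplectic, and `J₀` is a momentum map and a Poisson map
    ((∃! Ω : ∀ x : CotUn.Phase n, CotUn.Tan x →ₗ[ℝ] CotUn.Tan x →ₗ[ℝ] ℝ,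
        CotUn.IsExteriorDerivative CotUn.gamma0 Ω) ∧
      ∀ Ω : ∀ x : CotUn.Phase n, CotUn.Tan x →ₗ[ℝ] CotUn.Tan x →ₗ[ℝ] ℝ,
        CotUn.IsExteriorDerivative CotUn.gamma0 Ω →
          (∀ x : CotUn.Phase n, (Ω x).IsAlt ∧ (Ω x).Nondegenerate) ∧
          (∀ (ξ : CotUn.unn n) (x : CotUn.Phase n),
            ∃ (c : CotUn.SmoothCurve (CotUn.Phase n)) (V : CotUn.Tan x),
              (∀ t : ℝ, c.toFun t = CotUn.Lam (CotUn.expUnn (t • ξ)) x) ∧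
              (V : CotUn.Mat n × CotUn.Mat n) = c.vel 0 ∧
              CotUn.IsHamiltonianVector Ω (fun y => CotUn.traceForm n (CotUn.J0 y) ξ) x V) ∧
          ∀ f h : CotUn.unn n → ℝ, ContDiff ℝ ∞ f → ContDiff ℝ ∞ h → ∀ x : CotUn.Phase n,
            CotUn.IsPoissonBracket Ω (f ∘ CotUn.J0) (h ∘ CotUn.J0) x
              (CotUn.liePoisson f h (CotUn.J0 x))) ∧
    -- (iii) the Lie-Poisson bracket in the block coordinates `α`, `β`, `β⁺`, `δ`
    ((∀ f : CotUn.unn n → ℝ, ContDiff ℝ ∞ f → ∀ X : CotUn.unn n,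
        ∃ fα fβ fβ' fδ : CotUn.Mat n, CotUn.IsPartials f X fα fβ fβ' fδ) ∧
      ∀ f h : CotUn.unn n → ℝ, ContDiff ℝ ∞ f → ContDiff ℝ ∞ h →
        ∀ (α δ : CotUn.iH n) (β : CotUn.Mat n)
          (fα fβ fβ' fδ hα hβ hβ' hδ : CotUn.Mat n),
          CotUn.IsPartials f (CotUn.ofBlocks α β δ) fα fβ fβ' fδ →
          CotUn.IsPartials h (CotUn.ofBlocks α β δ) hα hβ hβ' hδ →
            ((CotUn.liePoisson f h (CotUn.ofBlocks α β δ) : ℝ) : ℂ) = Matrix.trace (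
              (α : CotUn.Mat n) * ((fα * hα - hα * fα) + fβ * hβ' - hβ * fβ') +
              β * (fβ' * hα + fδ * hβ' - hβ' * fα - hδ * fβ') +
              βᴴ * (fα * hβ + fβ * hδ - hα * fβ - hβ * fδ) +
              (δ : CotUn.Mat n) * ((fδ * hδ - hδ * fδ) + fβ' * hβ - hβ' * fβ))) := by
  refine ⟨⟨CotUn.isDiffeo_leftTriv n, fun Z => ?_⟩,
    ⟨CotUn.isDiffeo_I0base n, CotUn.isDiffeo_I0 n, fun _ => rfl, fun Z => ?_⟩,
    ⟨CotUn.Lam_one, CotUn.Lam_mul, CotUn.isSmooth_Lam, CotUn.Sig_one, CotUn.Sig_mul,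
      CotUn.isSmooth_Sig, CotUn.I0_Lam⟩,
    ⟨CotUn.ofReal_gamma0, CotUn.canonicalForm_leftTriv, CotUn.gamma0_invariant⟩,
    ⟨fun _ => rfl, CotUn.isSmooth_J0 n, CotUn.J0_equivariant⟩,
    ⟨⟨CotUn.omega, CotUn.isExteriorDerivative_omega n, fun Ω hΩ => hΩ.eq_omega⟩, ?_⟩,
    ⟨fun f _ X => CotUn.exists_isPartials f X,
      fun f h _ _ α δ β _ _ _ _ _ _ _ _ hf hh => CotUn.ofReal_liePoisson f h α δ β hf hh⟩⟩
  · exact ⟨LinearEquiv.ofBijective _ (CotUn.leftTrivFibre_bijective Z), fun ρ =>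
      ⟨rfl, CotUn.ofReal_leftPairing Z ρ⟩⟩
  · exact ⟨LinearEquiv.ofBijective _ (CotUn.I0Fibre_bijective Z), fun _ => rfl⟩
  · intro Ω hΩ
    rw [hΩ.eq_omega]
    refine ⟨fun x => ⟨CotUn.omega_isAlt x, CotUn.omega_nondegenerate x⟩, fun ξ x => ?_,
      fun f h hf hh x => CotUn.isPoissonBracket_liePoisson hf hh x⟩
    obtain ⟨a, b, d, h⟩ := CotUn.exists_ofBlocks_eq ξ.2
    obtain rfl := Subtype.ext h
    obtain ⟨c, V, hc, hV, h1, h2⟩ := CotUn.exists_curve_Lam_exp a d b x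
    exact ⟨c, V, hc, hV, CotUn.isHamiltonianVector_momentum a d b x V h1 h2⟩
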